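/- **Definitions.** A *dimension context* $\Psi$ is a finite list of distinct dimension variables or the inconsistent context $\bot$ (which has no variables). *Dimension terms* over $\Psi$ are built from the variables of $\Psi$ and constants $0,1$ by $\sim,\vee,\wedge$, and are considered equal when equal in the free De Morgan algebra on the variables; over $\bot$ all terms are equal. A term is *cartesian* (or *atomic*) if it is a variable, $0$ or $1$. A *contortion* $\psi:\Psi\to\Psi'$ with $\Psi'=(i_1,\dots,i_m)$ is a list $(r_1,\dots,r_m)$ of dimension terms over $\Psi$; into $\Psi'=\bot$ there is a (unique, empty) contortion only from $\Psi=\bot$. It is *cartesian* if all $r_k$ are; an atomic contortion is also called a *substitution*. $[\psi]$ denotes the replacement of each $i_k$ by $r_k$. For an atomic term $r$ and an endpoint $e\in\{0,1\}$, the context $\Psi.(r=e)$ is $\Psi$ without $i$ if $r$ is a variable $i$ of $\Psi$; it is $\bot$ if $r$ is the constant $1-e$; and it is $\Psi$ otherwise; $(r=e):\Psi.(r=e)\to\Psi$ is the evident substitution. *Cell contexts* $\Gamma$ and *contorted boundaries* are defined inductively. A cell context is a finite list of declarations $a:\Psi'[\phi']$, where $\phi'$ is a contorted boundary over $\Psi'$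 in the context of the preceding declarations. A *contorted cell* over $\Psi$ in $\Gamma$ is $a(\psi)$ with $a:\Psi'[\phi']$ in $\Gamma$ and $\psi:\Psi\to\Psi'$ a contortion. Equality of contorted cells over $\Psi$ is the equivalence relation generated by: equality of the terms of $\psi$; $a(\psi)=t[\psi]$ whenever $(r=e\mapsto t)$ is in $\phi'$ and $r[\psi]=e$ over $\Psi$; and all contorted cells over $\bot$ are equal. A contorted boundary $\phi$ over $\Psi$ is a finite list of entries $r=e\mapsto t$, with $r$ an atomic term over $\Psi$, $e\in\{0,1\}$ and $t$ a contorted cell over $\Psi.(r=e)$, such that $t$ agrees with $\phi_0[(r=e)]$, $\phi_0$ being the list of the preceding entries. Here a cell $t$ over $\Psi$ *agrees* with a boundary $\phi$ over $\Psi$ if $t[(r=e)]=t'$ over $\Psi.(r=e)$ for each entry $(r=e\mapsto t')$ of $\phi$. Given a contorted boundary $\phi$ over $\Psi$ in $\Gamma$, the problem $\mathrm{Cartesian}(\Gamma,\Psi,\phi)$ is to determine whether there are a declaration $a:\Psi'[\phi']$ in $\Gamma$ and a cartesian contortion $\psi:\Psi\to\Psi'$ such that $a(\psi)$ agrees with $\phi$.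 **Proposition.** For every fixed cell context $\Gamma$, the problem $\mathrm{Cartesian}(\Gamma,\Psi,\phi)$ is in P as a function of $\Psi$ and $\phi$. That is, there is a (multi-stack) Turing machine which, given the word over a fixed finite alphabet that writes out any dimension context $\Psi$ and any contorted boundary $\phi$ over $\Psi$ in $\Gamma$ (dimension variables being named by bit strings, dimension terms being written as formulas), decides $\mathrm{Cartesian}(\Gamma,\Psi,\phi)$ in time polynomial in the length of that word. -/

import Mathlib

namespace Cubical

/-! ### Dimension contexts and dimension terms -/

/-- Dimension variables are named by finite bit strings. -/
abbrev DVar := List Bool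

/-- A dimension context: a list of dimension variables, or the inconsistent context `⊥`. -/
inductive DCtx where
  | vars (l : List DVar)
  | bot

/-- The variables of a dimension context are unique. -/
def DCtx.Wf : DCtx → Prop
  | .vars l => l.Nodup
  | .bot => True

/-- `x` is one of the variables of `Ψ`. The inconsistent context has no variables. -/
def DCtx.Mem (x : DVar) : DCtx → Prop
  | .vars l => x ∈ l
  | .bot => False

/-- Raw (De Morgan) dimension terms; `const false` is the endpoint 0, `const true` is 1. -/
inductive DTerm where
  | var (x : DVar)
  | const (e : Bool)
  | neg (r : DTerm)
  | join (r s : DTerm)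
  | meet (r s : DTerm)

/-- All variables of the dimension term belong to `Ψ`. -/
def DTerm.Over (Ψ : DCtx) : DTerm → Prop
  | .var x => Ψ.Mem x
  | .const _ => True
  | .neg r => r.Over Ψ
  | .join r s => r.Over Ψ ∧ s.Over Ψ
  | .meet r s => r.Over Ψ ∧ s.Over Ψ

/-- Cartesian dimension terms: variables and the two constants. -/
def DTerm.IsCartesian : DTerm → Prop
  | .var _ => True
  | .const _ => True
  | _ => False

/-- The congruence generated by the laws of De Morgan algebras (bounded distributive lattices
with an involution satisfying the De Morgan laws): raw terms modulo `DMEq` form the free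
De Morgan algebra on the dimension variables. -/
inductive DMEq : DTerm → DTerm → Prop
  | refl (r) : DMEq r r
  | symm {r s} : DMEq r s → DMEq s r
  | trans {r s t} : DMEq r s → DMEq s t → DMEq r t
  | neg_congr {r r'} : DMEq r r' → DMEq (.neg r) (.neg r')
  | join_congr {r r' s s'} : DMEq r r' → DMEq s s' → DMEq (.join r s) (.join r' s')
  | meet_congr {r r' s s'} : DMEq r r' → DMEq s s' → DMEq (.meet r s) (.meet r' s')
  | neg_zero : DMEq (.neg (.const false)) (.const true)
  | neg_one : DMEq (.neg (.const true)) (.const false)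
  | neg_neg (r) : DMEq (.neg (.neg r)) r
  | neg_join (r s) : DMEq (.neg (.join r s)) (.meet (.neg r) (.neg s))
  | neg_meet (r s) : DMEq (.neg (.meet r s)) (.join (.neg r) (.neg s))
  | join_comm (r s) : DMEq (.join r s) (.join s r)
  | meet_comm (r s) : DMEq (.meet r s) (.meet s r)
  | join_assoc (r s t) : DMEq (.join (.join r s) t) (.join r (.join s t))
  | meet_assoc (r s t) : DMEq (.meet (.meet r s) t) (.meet r (.meet s t))
  | join_absorb (r s) : DMEq (.join r (.meet r s)) r
  | meet_absorb (r s) : DMEq (.meet r (.join r s)) r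
  | meet_distrib (r s t) : DMEq (.meet r (.join s t)) (.join (.meet r s) (.meet r t))
  | join_zero (r) : DMEq (.join r (.const false)) r
  | join_one (r) : DMEq (.join r (.const true)) (.const true)
  | join_self (r) : DMEq (.join r r) r

/-- Equality of dimension terms over `Ψ`; over `⊥` all dimension terms are equal. -/
def DimEq (Ψ : DCtx) (r s : DTerm) : Prop := Ψ = .bot ∨ DMEq r s

/-- Atomic dimension terms. -/
inductive Atom where
  | var (x : DVar)
  | const (e : Bool)

def Atom.toTerm : Atom → DTerm
  | .var x => .var x
  | .const e => .const e

/-- The variable, if any, of the atomic term belongs to `Ψ`. -/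
def Atom.Over (Ψ : DCtx) (r : Atom) : Prop := r.toTerm.Over Ψ

/-- Simultaneous replacement of the variables of a dimension term by dimension terms. -/
def DTerm.bind (σ : DVar → DTerm) : DTerm → DTerm
  | .var x => σ x
  | .const e => .const e
  | .neg r => .neg (r.bind σ)
  | .join r s => .join (r.bind σ) (s.bind σ)
  | .meet r s => .meet (r.bind σ) (s.bind σ)

/-! ### Constrained contexts -/

/-- The constrained dimension context, written `Ψ.(r = e)`. -/
def DCtx.con : DCtx → Atom → Bool → DCtx
  | .bot, _, _ => .bot
  | .vars l, .var i, _ => .vars (l.erase i)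
  | .vars l, .const b, e => if b = e then .vars l else .bot

/-- The constraining substitution `(r = e) : Ψ.(r = e) → Ψ`. It sends `r` to `e` if `r` is a
variable and is the identity if `r` is `e`. If `r` is the opposite of `e`, its domain is `⊥`,
where all dimension terms are equal, and it sends each variable to (say) the constant 0. -/
def conSubst : Atom → Bool → DVar → Atom
  | .var i, e, x => if x = i then .const e else .var x
  | .const b, e, x => if b = e then .var x else .const false

/-- The action of a substitution on atomic dimension terms. -/
def Atom.subst (σ : DVar → Atom) : Atom → Atom
  | .var x => σ x
  | .const e => .const e

/-! ### Contorted cells, boundaries and cell contexts -/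

/-- A raw contorted cell `a(r₁,…,r_n)`. The cell variable `a` is given by its position in the
cell context. -/
structure Cell where
  head : ℕ
  args : List DTerm

/-- A raw boundary entry `r = e ↦ t`. -/
structure Entry where
  dim : Atom
  side : Bool
  cell : Cell

/-- A raw contorted boundary: a list of entries, in order of introduction. -/
abbrev Bdy := List Entry

/-- A declaration `a : Ψ [φ]` of a cell variable. -/
structure Decl where
  ctx : DCtx
  bdy : Bdy

/-- A raw cell context, in order of introduction. -/
abbrev CellCtx := List Decl

/-- `IsContortion Ψ Ψ' ψ`: the list `ψ` of dimension terms over `Ψ` is a contortion `Ψ → Ψ'`. -/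
def IsContortion (Ψ : DCtx) : DCtx → List DTerm → Prop
  | .vars l, ψ => ψ.length = l.length ∧ ∀ r ∈ ψ, r.Over Ψ
  | .bot, ψ => Ψ = .bot ∧ ψ = []

/-- A contortion is cartesian if all of its dimension terms are. -/
def IsCartesianContortion (Ψ Ψ' : DCtx) (ψ : List DTerm) : Prop :=
  IsContortion Ψ Ψ' ψ ∧ ∀ r ∈ ψ, r.IsCartesian

/-- The term that the list `l ↦ ψ` assigns to a variable of `l` (0 on other variables, which
do not occur in terms over `l`). -/
def assignment : List DVar → List DTerm → DVar → DTerm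
  | y :: l, r :: ψ, x => if x = y then r else assignment l ψ x
  | _, _, _ => .const false

/-- The map on variables given by a contortion `ψ` into `Ψ'`. -/
def contortionMap : DCtx → List DTerm → DVar → DTerm
  | .vars l, ψ => assignment l ψ
  | .bot, _ => fun _ => .const false

/-- Replacement of the dimension variables of a contorted cell by dimension terms. -/
def Cell.bind (σ : DVar → DTerm) (t : Cell) : Cell :=
  ⟨t.head, t.args.map (DTerm.bind σ)⟩

/-- The action of a substitution on contorted cells. -/
def Cell.subst (σ : DVar → Atom) (t : Cell) : Cell := t.bind fun x => (σ x).toTerm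

/-- The action of a substitution `σ : Ψ' → Ψ` on a boundary over `Ψ`: the entry `r = e ↦ t`, with
`t` over `Ψ.(r = e)`, becomes `r[σ] = e ↦ t[σ]`, with `t[σ]` taken over `Ψ'.(r[σ] = e)`. -/
def Bdy.subst (σ : DVar → Atom) (φ : Bdy) : Bdy :=
  φ.map fun n => ⟨n.dim.subst σ, n.side, (n.cell.subst σ).subst (conSubst (n.dim.subst σ) n.side)⟩

/-- The judgement that `t` is a contorted cell over `Ψ` in the cell context `Γ`: a variable
of `Γ` with a contortion. -/
def IsCell (Γ : CellCtx) (Ψ : DCtx) (t : Cell) : Prop :=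
  ∃ d, Γ[t.head]? = some d ∧ IsContortion Ψ d.ctx t.args

/-- Equality of contorted cells over `Ψ` in the cell context `Γ`. -/
inductive CellEq (Γ : CellCtx) (Ψ : DCtx) : Cell → Cell → Prop
  | refl {t} : IsCell Γ Ψ t → CellEq Γ Ψ t t
  | symm {t u} : CellEq Γ Ψ t u → CellEq Γ Ψ u t
  | trans {t u v} : CellEq Γ Ψ t u → CellEq Γ Ψ u v → CellEq Γ Ψ t v
  /-- Contortions are lists of dimension terms modulo equality of dimension terms. -/
  | args {a : ℕ} {ψ ψ' : List DTerm} : IsCell Γ Ψ ⟨a, ψ⟩ → IsCell Γ Ψ ⟨a, ψ'⟩ →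
      List.Forall₂ (DimEq Ψ) ψ ψ' → CellEq Γ Ψ ⟨a, ψ⟩ ⟨a, ψ'⟩
  /-- If `a : Ψ' [φ]` is in `Γ`, `r = e ↦ t` is in `φ`, `ψ : Ψ → Ψ'` and `r[ψ] = e`, then
  `a(ψ) = t[ψ]`. -/
  | boundary {a : ℕ} {d : Decl} {n : Entry} {ψ : List DTerm} : Γ[a]? = some d → n ∈ d.bdy →
      IsContortion Ψ d.ctx ψ →
      DimEq Ψ (n.dim.toTerm.bind (contortionMap d.ctx ψ)) (.const n.side) →
      CellEq Γ Ψ ⟨a, ψ⟩ (n.cell.bind (contortionMap d.ctx ψ))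
  /-- All contorted cells are equal over `⊥`. -/
  | bot {t u} : Ψ = .bot → IsCell Γ Ψ t → IsCell Γ Ψ u → CellEq Γ Ψ t u

/-- `t` agrees with `φ`: `t[(r = e)]` equals `t'` for each entry `r = e ↦ t'` of `φ`. -/
def Agrees (Γ : CellCtx) (Ψ : DCtx) (t : Cell) (φ : Bdy) : Prop :=
  ∀ n ∈ φ, CellEq Γ (Ψ.con n.dim n.side) (t.subst (conSubst n.dim n.side)) n.cell

/-- The judgement that `t` is a contorted cell over `Ψ` agreeing with `φ`. -/
def HasBdy (Γ : CellCtx) (Ψ : DCtx) (t : Cell) (φ : Bdy) : Prop :=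
  IsCell Γ Ψ t ∧ Agrees Γ Ψ t φ

/-- The judgement that `φ` is a contorted boundary over `Ψ` in the cell context `Γ`. -/
inductive IsBdy (Γ : CellCtx) (Ψ : DCtx) : Bdy → Prop
  | nil : IsBdy Γ Ψ []
  | snoc {φ : Bdy} {r : Atom} {e : Bool} {t : Cell} : IsBdy Γ Ψ φ → r.Over Ψ →
      HasBdy Γ (Ψ.con r e) t (φ.subst (conSubst r e)) → IsBdy Γ Ψ (φ ++ [⟨r, e, t⟩])

/-- The judgement that `Γ` is a cell context. -/
inductive IsCellCtx : CellCtx → Prop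
  | nil : IsCellCtx []
  | snoc {Γ : CellCtx} {Ψ : DCtx} {φ : Bdy} : IsCellCtx Γ → Ψ.Wf → IsBdy Γ Ψ φ →
      IsCellCtx (Γ ++ [⟨Ψ, φ⟩])

/-! ### The Cartesian contortion problem -/

/-- The boundary problems over a fixed cell context `Γ`: a dimension context `Ψ` together with
a contorted boundary `φ` over `Ψ`. -/
structure BoundaryProblem (Γ : CellCtx) where
  ctx : DCtx
  bdy : Bdy
  ctx_wf : ctx.Wf
  isBdy : IsBdy Γ ctx bdy

/-- The problem `Cartesian(Γ, Ψ, φ)`: there are a variable `a : Ψ' [φ']` in `Γ` and a cartesian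
contortion `ψ : Ψ → Ψ'` such that `a(ψ)` agrees with `φ`. -/
def CartesianSolvable {Γ : CellCtx} (P : BoundaryProblem Γ) : Prop :=
  ∃ (a : ℕ) (d : Decl) (ψ : List DTerm), Γ[a]? = some d ∧
    IsCartesianContortion P.ctx d.ctx ψ ∧ HasBdy Γ P.ctx ⟨a, ψ⟩ P.bdy

/-! ### Encoding of boundary problems as words over a finite alphabet -/

/-- The input alphabet. -/
inductive Tok where
  | bit (b : Bool) | endName
  | const (e : Bool) | neg | join | meet
  | tick | sep | endEntry | bot | endCtx
  deriving DecidableEq, Fintype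

def encodeName (x : DVar) : List Tok := x.map .bit ++ [.endName]

/-- Dimension terms are written in reverse Polish notation. -/
def DTerm.encode : DTerm → List Tok
  | .var x => encodeName x
  | .const e => [.const e]
  | .neg r => r.encode ++ [.neg]
  | .join r s => r.encode ++ s.encode ++ [.join]
  | .meet r s => r.encode ++ s.encode ++ [.meet]

def DCtx.encode : DCtx → List Tok
  | .vars l => l.flatMap encodeName ++ [.endCtx]
  | .bot => [.bot]

/-- The position of the cell variable in unary, followed by the terms of the contortion. -/
def Cell.encode (t : Cell) : List Tok :=
  List.replicate t.head .tick ++ t.args.flatMap fun r => r.encode ++ [.sep]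

def Entry.encode (n : Entry) : List Tok :=
  n.dim.toTerm.encode ++ [.const n.side] ++ n.cell.encode ++ [.endEntry]

def Bdy.encode (φ : Bdy) : List Tok := φ.flatMap Entry.encode

def encodeRaw (p : DCtx × Bdy) : List Tok := p.1.encode ++ p.2.encode

/-- The word encoding a boundary problem. -/
def BoundaryProblem.encode {Γ : CellCtx} (P : BoundaryProblem Γ) : List Tok :=
  encodeRaw (P.ctx, P.bdy)

/-! The encoding is faithful: a one-pass parser recovers the boundary problem. -/

structure ParserState where
  name : List Bool
  stack : List DTerm
  ticks : ℕ
  ctx : DCtx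
  bdy : Bdy

def DTerm.toName : DTerm → DVar
  | .var x => x
  | _ => []

def DTerm.toAtom : DTerm → Atom
  | .var x => .var x
  | .const e => .const e
  | _ => .const false

def parseStep (s : ParserState) : Tok → ParserState
  | .bit b => { s with name := s.name ++ [b] }
  | .endName => { s with name := [], stack := .var s.name :: s.stack }
  | .const e => { s with stack := .const e :: s.stack }
  | .neg => match s.stack with
    | r :: st => { s with stack := .neg r :: st }
    | _ => s
  | .join => match s.stack with
    | r' :: r :: st => { s with stack := .join r r' :: st }
    | _ => s
  | .meet => match s.stack with
    | r' :: r :: st => { s with stack := .meet r r' :: st }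
    | _ => s
  | .tick => { s with ticks := s.ticks + 1 }
  | .sep => s
  | .endEntry => match s.stack.reverse with
    | r :: .const e :: ψ =>
      { s with stack := [], ticks := 0, bdy := s.bdy ++ [⟨r.toAtom, e, ⟨s.ticks, ψ⟩⟩] }
    | _ => s
  | .bot => { s with ctx := .bot }
  | .endCtx => { s with stack := [], ctx := .vars (s.stack.reverse.map DTerm.toName) }

def parse (w : List Tok) : DCtx × Bdy :=
  let s := w.foldl parseStep ⟨[], [], 0, .bot, []⟩
  (s.ctx, s.bdy)

theorem foldl_encodeName (x : DVar) (st k Ψ φ) (y : List Bool) :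
    (encodeName x).foldl parseStep ⟨y, st, k, Ψ, φ⟩ = ⟨[], .var (y ++ x) :: st, k, Ψ, φ⟩ := by
  induction x generalizing y with
  | nil => simp [encodeName, parseStep]
  | cons b x ih => simpa [encodeName, parseStep] using ih (y ++ [b])

theorem foldl_encodeTerm (r : DTerm) (st k Ψ φ) :
    r.encode.foldl parseStep ⟨[], st, k, Ψ, φ⟩ = ⟨[], r :: st, k, Ψ, φ⟩ := by
  induction r generalizing st with
  | var x => simpa [DTerm.encode] using foldl_encodeName x st k Ψ φ []
  | const e => simp [DTerm.encode, parseStep]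
  | neg r ih => simp [DTerm.encode, ih, parseStep]
  | join r s ihr ihs => simp [DTerm.encode, ihr, ihs, parseStep]
  | meet r s ihr ihs => simp [DTerm.encode, ihr, ihs, parseStep]

theorem foldl_encodeArgs (ψ : List DTerm) (st k Ψ φ) :
    (ψ.flatMap fun r => r.encode ++ [.sep]).foldl parseStep ⟨[], st, k, Ψ, φ⟩ =
      ⟨[], ψ.reverse ++ st, k, Ψ, φ⟩ := by
  induction ψ generalizing st with
  | nil => simp
  | cons r ψ ih => simp [foldl_encodeTerm, parseStep, ih]

theorem foldl_ticks (m : ℕ) (st k Ψ φ) :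
    (List.replicate m Tok.tick).foldl parseStep ⟨[], st, k, Ψ, φ⟩ = ⟨[], st, k + m, Ψ, φ⟩ := by
  induction m generalizing k with
  | zero => simp
  | succ m ih => simp [List.replicate_succ, parseStep, ih, Nat.add_assoc, Nat.add_comm 1 m]

theorem toAtom_toTerm (r : Atom) : r.toTerm.toAtom = r := by cases r <;> rfl

theorem foldl_encodeBdy (φ : Bdy) (Ψ φ₀) :
    φ.encode.foldl parseStep ⟨[], [], 0, Ψ, φ₀⟩ = ⟨[], [], 0, Ψ, φ₀ ++ φ⟩ := by
  induction φ generalizing φ₀ with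
  | nil => simp [Bdy.encode]
  | cons n φ ih =>
    have h := ih (φ₀ ++ [n])
    simp only [Bdy.encode] at h
    simp [Bdy.encode, Entry.encode, Cell.encode, foldl_encodeTerm, foldl_ticks, foldl_encodeArgs,
      parseStep, toAtom_toTerm, h]

theorem foldl_names (l : List DVar) (st k Ψ φ) :
    (l.flatMap encodeName).foldl parseStep ⟨[], st, k, Ψ, φ⟩ =
      ⟨[], (l.map DTerm.var).reverse ++ st, k, Ψ, φ⟩ := by
  induction l generalizing st with
  | nil => simp
  | cons x l ih => simp [foldl_encodeName, ih]

theorem parse_encodeRaw (p : DCtx × Bdy) : parse (encodeRaw p) = p := by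
  obtain ⟨Ψ, φ⟩ := p
  cases Ψ with
  | bot => simp [parse, encodeRaw, DCtx.encode, parseStep, foldl_encodeBdy]
  | vars l =>
    simp [parse, encodeRaw, DCtx.encode, parseStep, foldl_encodeBdy, foldl_names,
      Function.comp_def, DTerm.toName]

theorem BoundaryProblem.encode_injective {Γ : CellCtx} :
    Function.Injective (BoundaryProblem.encode (Γ := Γ)) := by
  rintro ⟨Ψ, φ, h₁, h₂⟩ ⟨Ψ', φ', h₁', h₂'⟩ h
  have := congrArg parse h
  simp only [BoundaryProblem.encode, parse_encodeRaw, Prod.mk.injEq] at this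
  obtain ⟨rfl, rfl⟩ := this
  rfl

/-! ### Polynomial time -/

/-- The decision problem `p` on the instances `α`, encoded as words over a finite alphabet, is
in P: a multi-stack Turing machine decides it in time polynomial in the length of the word. -/
def InP {α A : Type} [Fintype A] (enc : α → List A) (p : α → Prop) : Prop :=
  ∃ f : α → Bool, (∀ x, f x = true ↔ p x) ∧
    Nonempty (Turing.TM2ComputableInPolyTime enc Computability.encodeBool f)

end Cubical

/-! Since `Γ` is fixed, a cartesian contortion out of `Ψ` consists of at most `K` atomic terms,
where `K` bounds the lengths of the contexts in `Γ`. For an input of length n there are at most (n +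
2)^K candidates, and all of them can be tried. The difficulty is to test one candidate: the boundary
contains arbitrary De Morgan terms, and a comparison under all valuations of the variables of `Ψ`
would take exponential time.

Equality of cells is first reduced to equality of normal forms. Two terms are equal in the free De
Morgan algebra iff they have equal values under all valuations in the four-element algebra
(`dmEq_iff_val`, by the prime ideal theorem). A cell `a(ψ)` is rewritten by the first entry of the
boundary of `a` that applies. The new head precedes `a`, so this stops, and the coherence required
of boundaries makes the choice of the entry immaterial (`IsBdy.cellEq_of_fires`). Over a context
other than `⊥`, cells are equal iff their normal forms are (`cellEq_iff_nf`).

The crux is that terms are monotone for the product order on `Four`, in which negation merely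
exchanges the components. If `f` is monotone and `g` depends only on the variables in `X`, then `f =
g` as soon as they agree on the valuations that are constant off `X`: filling in the least and the
greatest element off `X` encloses `f` between two equal values (`eq_of_comp_eq`). One side of each
comparison is a cartesian cell with at most `K` variables, so all other variables may be identified
with each other (`nf_eq_iff`). Terms are therefore evaluated in an algebra `MVal K` whose size does
not depend on the input, and a variable counts only through the set of positions at which the
candidate uses it (`entryOK_iff`).

The machine is written as a structured program with a cost semantics and compiled to a multi-stack
machine (`Exec.stepsTo`). The constants of the candidate are kept in the register; its variables are
kept as marks on the names in the word. One pass over the word evaluates the reverse Polish notation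
on a stack of elements of `MVal K`, with a bounded number of steps per token, because the test of an
entry is a finite table. Nested loops over the `K` positions give a polynomial bound (`runsSearch`).
-/

namespace Cubical

/-! ### The four-element De Morgan algebra -/

/-- The four-element De Morgan algebra. The components of an element record the truth of a
statement and of its negation. -/
abbrev Four := Bool × Bool

def Four.const (e : Bool) : Four := (e, !e)

/-- Evaluation of a dimension term at a valuation in the four-element De Morgan algebra. -/
def DTerm.val (v : DVar → Four) : DTerm → Four
  | .var x => v x
  | .const e => Four.const e
  | .neg r => ((r.val v).2, (r.val v).1)
  | .join r s => ((r.val v).1 || (s.val v).1, (r.val v).2 && (s.val v).2)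
  | .meet r s => ((r.val v).1 && (s.val v).1, (r.val v).2 || (s.val v).2)

theorem DTerm.val_bind (σ : DVar → DTerm) (v : DVar → Four) (r : DTerm) :
    (r.bind σ).val v = r.val fun x => (σ x).val v := by
  induction r with
  | var x => rfl
  | const e => rfl
  | neg r ih => simp [DTerm.bind, DTerm.val, ih]
  | join r s ihr ihs => simp [DTerm.bind, DTerm.val, ihr, ihs]
  | meet r s ihr ihs => simp [DTerm.bind, DTerm.val, ihr, ihs]

theorem DMEq.val_eq {r s : DTerm} (h : DMEq r s) (v : DVar → Four) : r.val v = s.val v := by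
  induction h with
  | refl => rfl
  | symm _ ih => exact ih.symm
  | trans _ _ ih₁ ih₂ => exact ih₁.trans ih₂
  | neg_congr _ ih => simp [DTerm.val, ih]
  | join_congr _ _ ih₁ ih₂ => simp [DTerm.val, ih₁, ih₂]
  | meet_congr _ _ ih₁ ih₂ => simp [DTerm.val, ih₁, ih₂]
  | neg_zero => rfl
  | neg_one => rfl
  | neg_neg => rfl
  | neg_join => rfl
  | neg_meet => rfl
  | join_comm r s => simp [DTerm.val, Bool.or_comm, Bool.and_comm]
  | meet_comm r s => simp [DTerm.val, Bool.or_comm, Bool.and_comm]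
  | join_assoc r s t => simp [DTerm.val, Bool.or_assoc, Bool.and_assoc]
  | meet_assoc r s t => simp [DTerm.val, Bool.or_assoc, Bool.and_assoc]
  | join_absorb r s =>
    simp only [DTerm.val]
    rcases r.val v with ⟨_ | _, _ | _⟩ <;> rcases s.val v with ⟨_ | _, _ | _⟩ <;> rfl
  | meet_absorb r s =>
    simp only [DTerm.val]
    rcases r.val v with ⟨_ | _, _ | _⟩ <;> rcases s.val v with ⟨_ | _, _ | _⟩ <;> rfl
  | meet_distrib r s t =>
    simp only [DTerm.val]
    rcases r.val v with ⟨_ | _, _ | _⟩ <;> rcases s.val v with ⟨_ | _, _ | _⟩ <;>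
      rcases t.val v with ⟨_ | _, _ | _⟩ <;> rfl
  | join_zero r => simp [DTerm.val, Four.const]
  | join_one r => simp [DTerm.val, Four.const]
  | join_self r => simp [DTerm.val]

/-! ### Completeness of the four-element De Morgan algebra -/

instance dmSetoid : Setoid DTerm := ⟨DMEq, .refl, .symm, .trans⟩

/-- The free De Morgan algebra. -/
abbrev FreeDM := Quotient dmSetoid

namespace FreeDM

instance : Max FreeDM :=
  ⟨Quotient.map₂ DTerm.join fun _ _ h _ _ h' => DMEq.join_congr h h'⟩

instance : Min FreeDM :=
  ⟨Quotient.map₂ DTerm.meet fun _ _ h _ _ h' => DMEq.meet_congr h h'⟩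

instance : Lattice FreeDM :=
  Lattice.mk'
    (by rintro ⟨a⟩ ⟨b⟩; exact Quotient.sound (.join_comm a b))
    (by rintro ⟨a⟩ ⟨b⟩ ⟨c⟩; exact Quotient.sound (.join_assoc a b c))
    (by rintro ⟨a⟩ ⟨b⟩; exact Quotient.sound (.meet_comm a b))
    (by rintro ⟨a⟩ ⟨b⟩ ⟨c⟩; exact Quotient.sound (.meet_assoc a b c))
    (by rintro ⟨a⟩ ⟨b⟩; exact Quotient.sound (.join_absorb a b))
    (by rintro ⟨a⟩ ⟨b⟩; exact Quotient.sound (.meet_absorb a b))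

instance : DistribLattice FreeDM :=
  DistribLattice.ofInfSupLe (by
    rintro ⟨a⟩ ⟨b⟩ ⟨c⟩
    exact le_of_eq (Quotient.sound (.meet_distrib a b c)))

def mk (r : DTerm) : FreeDM := Quotient.mk _ r

theorem mk_eq {r s : DTerm} : mk r = mk s ↔ DMEq r s := Quotient.eq

theorem mk_join (r s : DTerm) : mk (.join r s) = mk r ⊔ mk s := rfl

theorem mk_meet (r s : DTerm) : mk (.meet r s) = mk r ⊓ mk s := rfl

theorem zero_le (a : FreeDM) : mk (.const false) ≤ a := by
  obtain ⟨a⟩ := a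
  exact sup_eq_left.1 (Quotient.sound (.join_zero a) : mk a ⊔ mk (.const false) = mk a)

theorem le_one (a : FreeDM) : a ≤ mk (.const true) := by
  obtain ⟨a⟩ := a
  exact sup_eq_right.1 (Quotient.sound (.join_one a) : mk a ⊔ mk (.const true) = _)

/-- The valuation given by a prime ideal of the free De Morgan algebra. -/
noncomputable def valuation (J : Order.Ideal FreeDM) (x : DVar) : Four :=
  open Classical in (decide (mk (.var x) ∉ J), decide (mk (.neg (.var x)) ∉ J))

-- For a prime ideal, non-membership respects joins and meets, and the De Morgan laws push negations
-- inwards. Both components are carried through the induction because negation exchanges them.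
open Classical in
theorem val_valuation (J : Order.Ideal FreeDM) (hJ : J.IsPrime) (r : DTerm) :
    r.val (valuation J) = (decide (mk r ∉ J), decide (mk (.neg r) ∉ J)) := by
  have h0 : mk (.const false) ∈ J := by
    obtain ⟨x, hx⟩ := J.nonempty'
    exact J.lower (zero_le x) hx
  have h1 : mk (.const true) ∉ J := fun h =>
    hJ.toIsProper.ne_univ (Set.eq_univ_of_forall fun x => J.lower (le_one x) h)
  have hsup : ∀ a b : FreeDM, a ⊔ b ∈ J ↔ a ∈ J ∧ b ∈ J := fun a b => Order.Ideal.sup_mem_iff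
  have hinf : ∀ a b : FreeDM, a ⊓ b ∈ J ↔ a ∈ J ∨ b ∈ J := fun a b =>
    ⟨fun h => hJ.mem_or_mem h, fun h => h.elim (J.lower inf_le_left) (J.lower inf_le_right)⟩
  induction r with
  | var x => rfl
  | const e =>
    cases e
    · simp [DTerm.val, Four.const, h0, mk_eq.2 DMEq.neg_zero, h1]
    · simp [DTerm.val, Four.const, h0, mk_eq.2 DMEq.neg_one, h1]
  | neg r ih => simp [DTerm.val, ih, mk_eq.2 (DMEq.neg_neg r)]
  | join r s ihr ihs =>
    simp [DTerm.val, ihr, ihs, mk_eq.2 (DMEq.neg_join r s), mk_join, mk_meet, hsup, hinf,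
      imp_iff_not_or]
  | meet r s ihr ihs =>
    simp [DTerm.val, ihr, ihs, mk_eq.2 (DMEq.neg_meet r s), mk_join, mk_meet, hsup, hinf,
      imp_iff_not_or]

/-- If the inequality failed, the prime ideal theorem would give a prime ideal containing `mk s` but
not `mk r`, and its valuation would separate the terms in the first component. -/
theorem mk_le_of_val_eq {r s : DTerm} (h : ∀ v, r.val v = s.val v) : mk r ≤ mk s := by
  classical
  by_contra hle
  obtain ⟨J, hJ, hsJ, hd⟩ := DistribLattice.prime_ideal_of_disjoint_filter_ideal
    (F := Order.PFilter.principal (mk r)) (I := Order.Ideal.principal (mk s)) (by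
      rw [Set.disjoint_left]
      intro x hx hx'
      exact hle (le_trans (by simpa using hx) (by simpa using hx')))
  have h1 : mk s ∈ J := hsJ (by simp)
  have h2 : mk r ∉ J := fun h => Set.disjoint_left.1 hd (by simp) h
  have := h (valuation J)
  simp [val_valuation J hJ, h1, h2] at this

end FreeDM

/-- Soundness and completeness together: from here on, equations between terms can be checked by
evaluation. -/
theorem dmEq_iff_val {r s : DTerm} : DMEq r s ↔ ∀ v, r.val v = s.val v :=
  ⟨fun h v => h.val_eq v, fun h => FreeDM.mk_eq.1
    (le_antisymm (FreeDM.mk_le_of_val_eq h) (FreeDM.mk_le_of_val_eq fun v => (h v).symm))⟩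

/-! ### Substitution in contorted cells -/

theorem DTerm.bind_bind (σ τ : DVar → DTerm) (r : DTerm) :
    (r.bind σ).bind τ = r.bind fun x => (σ x).bind τ := by
  induction r with
  | var x => rfl
  | const e => rfl
  | neg r ih => simp [DTerm.bind, ih]
  | join r s ihr ihs => simp [DTerm.bind, ihr, ihs]
  | meet r s ihr ihs => simp [DTerm.bind, ihr, ihs]

theorem Cell.bind_bind (σ τ : DVar → DTerm) (t : Cell) :
    (t.bind σ).bind τ = t.bind fun x => (σ x).bind τ := by
  simp [Cell.bind, DTerm.bind_bind]

theorem DTerm.Over.bind {Ψ Ψ' : DCtx} {σ : DVar → DTerm}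
    (hσ : ∀ x, Ψ.Mem x → (σ x).Over Ψ') {r : DTerm} (h : r.Over Ψ) : (r.bind σ).Over Ψ' := by
  induction r with
  | var x => exact hσ x h
  | const e => trivial
  | neg r ih => exact ih h
  | join r s ihr ihs => exact ⟨ihr h.1, ihs h.2⟩
  | meet r s ihr ihs => exact ⟨ihr h.1, ihs h.2⟩

theorem DMEq.bind {r s : DTerm} (h : DMEq r s) (σ : DVar → DTerm) :
    DMEq (r.bind σ) (s.bind σ) :=
  dmEq_iff_val.2 fun v => by simp only [DTerm.val_bind, h.val_eq]

theorem DMEq.bind_of_forall {σ τ : DVar → DTerm} (h : ∀ x, DMEq (σ x) (τ x)) (r : DTerm) :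
    DMEq (r.bind σ) (r.bind τ) :=
  dmEq_iff_val.2 fun v => by simp only [DTerm.val_bind, fun x => (h x).val_eq v]

/-- Consistency of the De Morgan laws. An entry whose dimension term is the endpoint opposite to its
side therefore never applies. -/
theorem not_dmEq_const {e : Bool} : ¬ DMEq (.const (!e)) (.const e) := fun h => by
  have := h.val_eq fun _ => (true, true)
  cases e <;> simp [DTerm.val, Four.const] at this

theorem IsContortion.bind {Ψ Ψ' Ψ₀ : DCtx} {ψ : List DTerm} (h : IsContortion Ψ Ψ₀ ψ)
    {σ : DVar → DTerm} (hσ : ∀ x, Ψ.Mem x → (σ x).Over Ψ') (hbot : Ψ = .bot → Ψ' = .bot) :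
    IsContortion Ψ' Ψ₀ (ψ.map (DTerm.bind σ)) := by
  cases Ψ₀ with
  | vars l =>
    refine ⟨by simpa using h.1, fun r hr => ?_⟩
    obtain ⟨s, hs, rfl⟩ := List.mem_map.1 hr
    exact (h.2 s hs).bind hσ
  | bot => exact ⟨hbot h.1, by simp [h.2]⟩

theorem IsCell.bind {Γ : CellCtx} {Ψ Ψ' : DCtx} {t : Cell} (h : IsCell Γ Ψ t)
    {σ : DVar → DTerm} (hσ : ∀ x, Ψ.Mem x → (σ x).Over Ψ') (hbot : Ψ = .bot → Ψ' = .bot) :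
    IsCell Γ Ψ' (t.bind σ) :=
  let ⟨d, hd, hc⟩ := h
  ⟨d, hd, hc.bind hσ hbot⟩

theorem assignment_bind (σ : DVar → DTerm) (l : List DVar) (ψ : List DTerm) (x : DVar) :
    (assignment l ψ x).bind σ = assignment l (ψ.map (DTerm.bind σ)) x := by
  induction l generalizing ψ with
  | nil => rfl
  | cons y l ih =>
    cases ψ with
    | nil => rfl
    | cons r ψ =>
      simp only [assignment, List.map_cons]
      split
      · rfl
      · exact ih ψ

theorem contortionMap_bind (σ : DVar → DTerm) (Ψ : DCtx) (ψ : List DTerm) (x : DVar) :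
    (contortionMap Ψ ψ x).bind σ = contortionMap Ψ (ψ.map (DTerm.bind σ)) x := by
  cases Ψ with
  | vars l => exact assignment_bind σ l ψ x
  | bot => rfl

theorem assignment_over {Ψ : DCtx} {l : List DVar} {ψ : List DTerm} (h : ∀ r ∈ ψ, r.Over Ψ)
    (x : DVar) : (assignment l ψ x).Over Ψ := by
  induction l generalizing ψ with
  | nil => trivial
  | cons y l ih =>
    cases ψ with
    | nil => trivial
    | cons r ψ =>
      simp only [assignment]
      split
      · exact h r (by simp)
      · exact ih fun s hs => h s (by simp [hs])

theorem IsContortion.contortionMap_over {Ψ Ψ' : DCtx} {ψ : List DTerm}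
    (h : IsContortion Ψ Ψ' ψ) (x : DVar) : (contortionMap Ψ' ψ x).Over Ψ := by
  cases Ψ' with
  | vars l => exact assignment_over h.2 x
  | bot => trivial

/-- Every generating rule is stable under replacement. Both the rule identifying all cells over `⊥`
and contortions into `⊥` force the condition `hbot`. -/
theorem CellEq.bind {Γ : CellCtx} {Ψ Ψ' : DCtx} {t u : Cell} (h : CellEq Γ Ψ t u)
    {σ : DVar → DTerm} (hσ : ∀ x, Ψ.Mem x → (σ x).Over Ψ') (hbot : Ψ = .bot → Ψ' = .bot) :
    CellEq Γ Ψ' (t.bind σ) (u.bind σ) := by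
  have dim : ∀ r s, DimEq Ψ r s → DimEq Ψ' (r.bind σ) (s.bind σ) := fun r s h =>
    h.imp hbot fun h => h.bind σ
  induction h with
  | refl h => exact .refl (h.bind hσ hbot)
  | symm _ ih => exact .symm ih
  | trans _ _ ih₁ ih₂ => exact .trans ih₁ ih₂
  | args h h' hψ =>
    refine .args (h.bind hσ hbot) (h'.bind hσ hbot) ?_
    rw [List.forall₂_map_left_iff, List.forall₂_map_right_iff]
    exact hψ.imp dim
  | boundary ha hn hψ hr =>
    rw [Cell.bind_bind]
    simp only [contortionMap_bind]
    refine .boundary ha hn (hψ.bind hσ hbot) ?_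
    have := dim _ _ hr
    rw [DTerm.bind_bind] at this
    simp only [contortionMap_bind] at this
    exact this
  | bot h ht hu => exact .bot (hbot h) (ht.bind hσ hbot) (hu.bind hσ hbot)

theorem IsCell.mono {Γ Γ' : CellCtx} (hΓ : ∀ (a : ℕ) d, Γ[a]? = some d → Γ'[a]? = some d)
    {Ψ : DCtx} {t : Cell} (h : IsCell Γ Ψ t) : IsCell Γ' Ψ t :=
  let ⟨d, hd, hc⟩ := h
  ⟨d, hΓ _ _ hd, hc⟩

theorem cellEq_bind_congr {Γ : CellCtx} {Ψ : DCtx} {t : Cell} {σ τ : DVar → DTerm}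
    (hσ : IsCell Γ Ψ (t.bind σ)) (hτ : IsCell Γ Ψ (t.bind τ)) (h : ∀ x, DMEq (σ x) (τ x)) :
    CellEq Γ Ψ (t.bind σ) (t.bind τ) := by
  refine .args hσ hτ ?_
  rw [List.forall₂_map_left_iff, List.forall₂_map_right_iff]
  exact List.forall₂_same.2 fun r _ => Or.inr (DMEq.bind_of_forall h r)

/-! ### Boundaries -/

/-- Constraining yields `⊥` only at the endpoint opposite to `e`, which is not equal to `e`. This
discharges the condition `hbot` of `CellEq.bind` whenever an entry applies. -/
theorem DCtx.con_ne_bot {Ψ : DCtx} (hΨ : Ψ ≠ .bot) {r : Atom} {e : Bool} {σ : DVar → DTerm}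
    (h : DMEq (r.toTerm.bind σ) (.const e)) : Ψ.con r e ≠ .bot := by
  rcases Ψ with l | _
  · rcases r with i | b
    · simp [DCtx.con]
    · simp only [DCtx.con]
      split
      · simp
      · rename_i hb
        obtain rfl : b = !e := by cases b <;> cases e <;> simp_all
        exact (not_dmEq_const h).elim
  · exact absurd rfl hΨ

/-- A replacement that makes `r` equal to `e` factors, up to equality, through the constraining
substitution. -/
theorem conSubst_bind {r : Atom} {e : Bool} {σ : DVar → DTerm}
    (h : DMEq (r.toTerm.bind σ) (.const e)) (x : DVar) :
    DMEq ((conSubst r e x).toTerm.bind σ) (σ x) := by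
  rcases r with i | b
  · simp only [conSubst]
    split
    · subst x
      exact h.symm
    · exact .refl _
  · simp only [conSubst]
    split
    · exact .refl _
    · obtain rfl : b = !e := by cases b <;> cases e <;> simp_all
      exact (not_dmEq_const h).elim

theorem conSubst_bind_over {Ψ : DCtx} {r : Atom} {e : Bool} {σ : DVar → DTerm} {x : DVar}
    (h : (σ x).Over Ψ) : ((conSubst r e x).toTerm.bind σ).Over Ψ := by
  rcases r with i | b <;> simp only [conSubst] <;> split <;> trivial

theorem Atom.toTerm_subst (r : Atom) (s : DVar → Atom) :
    (r.subst s).toTerm = r.toTerm.bind fun x => (s x).toTerm := by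
  cases r <;> rfl

theorem IsBdy.isCell {Γ : CellCtx} {Ψ : DCtx} {φ : Bdy} (h : IsBdy Γ Ψ φ) :
    ∀ n ∈ φ, n.dim.Over Ψ ∧ IsCell Γ (Ψ.con n.dim n.side) n.cell := by
  induction h with
  | nil => simp
  | snoc _ hr ht ih =>
    intro n hn
    rcases List.mem_append.1 hn with hn | hn
    · exact ih n hn
    · obtain rfl := List.mem_singleton.1 hn
      exact ⟨hr, ht.1⟩

/-- Any two boundary entries that apply under a contortion give equal cells. -/
theorem IsBdy.cellEq_of_fires {Γ : CellCtx} {Ψ : DCtx} {φ : Bdy} (h : IsBdy Γ Ψ φ)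
    (hΨ : Ψ ≠ .bot) {Ψ' : DCtx} {σ : DVar → DTerm} (hσ : ∀ x, (σ x).Over Ψ') :
    ∀ n ∈ φ, ∀ n' ∈ φ, DMEq (n.dim.toTerm.bind σ) (.const n.side) →
      DMEq (n'.dim.toTerm.bind σ) (.const n'.side) →
      CellEq Γ Ψ' (n.cell.bind σ) (n'.cell.bind σ) := by
  induction h with
  | nil => simp
  | @snoc φ r e t hφ hr ht ih =>
    -- This compares the last entry with an earlier one. By its typing, `t` agrees with the earlier
    -- entries restricted along `(r = e)`, and `σ` factors through this restriction and the one of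
    -- the earlier entry.
    have key : ∀ n ∈ φ, DMEq (n.dim.toTerm.bind σ) (.const n.side) →
        DMEq (r.toTerm.bind σ) (.const e) → CellEq Γ Ψ' (t.bind σ) (n.cell.bind σ) := by
      intro n hn hf hr
      have h1 := ht.2 _ (List.mem_map_of_mem hn)
      have hΨr := DCtx.con_ne_bot hΨ hr
      have hs := conSubst_bind hr
      have hf' : DMEq ((n.dim.subst (conSubst r e)).toTerm.bind σ) (.const n.side) := by
        rw [Atom.toTerm_subst, DTerm.bind_bind]
        exact (DMEq.bind_of_forall hs _).trans hf
      have hs' := conSubst_bind hf'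
      have h2 := h1.bind (Ψ' := Ψ') (σ := σ) (fun x _ => hσ x)
        fun h => absurd h (DCtx.con_ne_bot hΨr hf')
      simp only [Cell.subst, Cell.bind_bind] at h2
      have c1 : IsCell Γ Ψ' (t.bind σ) := ht.1.bind (fun x _ => hσ x) fun h => absurd h hΨr
      have c2 : IsCell Γ Ψ' (n.cell.bind σ) := (hφ.isCell n hn).2.bind (fun x _ => hσ x)
        fun h => absurd h (DCtx.con_ne_bot hΨ hf)
      refine .trans (.symm (cellEq_bind_congr ?_ c1 hs')) (.trans h2 (cellEq_bind_congr ?_ c2 ?_))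
      · exact ht.1.bind (fun x _ => conSubst_bind_over (hσ x)) fun h => absurd h hΨr
      · refine (hφ.isCell n hn).2.bind (fun x _ => ?_)
          fun h => absurd h (DCtx.con_ne_bot hΨ hf)
        rw [DTerm.bind_bind]
        exact conSubst_bind_over (σ := fun y => (conSubst _ _ y).toTerm.bind σ)
          (conSubst_bind_over (hσ x))
      · intro x
        rw [DTerm.bind_bind]
        exact (DMEq.bind_of_forall hs' _).trans (hs x)
    intro n hn n' hn' hf hf'
    rcases List.mem_append.1 hn with hn | hn <;> rcases List.mem_append.1 hn' with hn' | hn'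
    · exact ih n hn n' hn' hf hf'
    · obtain rfl := List.mem_singleton.1 hn'
      exact .symm (key n hn hf hf')
    · obtain rfl := List.mem_singleton.1 hn
      exact key n' hn' hf' hf
    · obtain rfl := List.mem_singleton.1 hn
      obtain rfl := List.mem_singleton.1 hn'
      exact .refl (ht.1.bind (fun x _ => hσ x) fun h => absurd h (DCtx.con_ne_bot hΨ hf))

/-- A boundary mentions only declarations that precede it; this is why rewriting by boundary entries
terminates. -/
theorem IsCellCtx.isBdy_take {Γ : CellCtx} (h : IsCellCtx Γ) :
    ∀ (a : ℕ) d, Γ[a]? = some d → IsBdy (Γ.take a) d.ctx d.bdy := by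
  induction h with
  | nil => simp
  | @snoc Γ Ψ φ _ _ hφ ih =>
    intro a d hd
    rcases lt_trichotomy a Γ.length with h | h | h
    · rw [List.getElem?_append_left h] at hd
      rw [List.take_append_of_le_length h.le]
      exact ih a d hd
    · subst h
      simp at hd
      subst hd
      simpa using hφ
    · rw [List.getElem?_eq_none (by simp; omega)] at hd
      cases hd

/-! ### Normal forms of contorted cells

Contorted cells are interpreted as a cell variable together with a list of functions `V → Four`.
Boundary entries are applied as long as possible. -/

/-- The names of the variables of a dimension context. -/
def DCtx.names : DCtx → List DVar
  | .vars l => l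
  | .bot => []

/-- The interpretation of a dimension term given an interpretation of variables. -/
def DTerm.sem {V : Type} (ρ : DVar → V → Four) (r : DTerm) : V → Four :=
  fun z => r.val fun x => ρ x z

/-- The interpretation of variables given by a list of values. -/
def assign {V : Type} : List DVar → List (V → Four) → DVar → V → Four
  | y :: l, r :: ψ, x => if x = y then r else assign l ψ x
  | _, _, _ => fun _ => Four.const false

theorem assign_map_sem {V : Type} (ρ : DVar → V → Four) (Ψ : DCtx) (ψ : List DTerm) (x : DVar) :
    assign Ψ.names (ψ.map (DTerm.sem ρ)) x = (contortionMap Ψ ψ x).sem ρ := by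
  rcases Ψ with l | _
  · simp only [DCtx.names, contortionMap]
    induction l generalizing ψ with
    | nil => rfl
    | cons y l ih =>
      cases ψ with
      | nil => rfl
      | cons r ψ =>
        simp only [assign, assignment, List.map_cons]
        split
        · rfl
        · exact ih ψ
  · rfl

theorem assign_map_comp {V W : Type} (h : W → V) (l : List DVar) (ψ : List (V → Four))
    (x : DVar) : assign l (ψ.map (· ∘ h)) x = assign l ψ x ∘ h := by
  induction l generalizing ψ with
  | nil => rfl
  | cons y l ih =>
    cases ψ with
    | nil => rfl
    | cons r ψ =>
      simp only [assign, List.map_cons]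
      split
      · rfl
      · exact ih ψ

theorem DTerm.sem_bind {V : Type} (ρ : DVar → V → Four) (σ : DVar → DTerm) (r : DTerm) :
    (r.bind σ).sem ρ = r.sem fun x => (σ x).sem ρ := by
  funext z
  exact r.val_bind σ _

def namesAt (Γ : CellCtx) (a : ℕ) : List DVar := (Γ[a]?.map fun d => d.ctx.names).getD []

def bdyAt (Γ : CellCtx) (a : ℕ) : Bdy := (Γ[a]?.map Decl.bdy).getD []

/-- The first boundary entry that applies to a cell. -/
noncomputable def firing (Γ : CellCtx) {V : Type} (a : ℕ) (ψ : List (V → Four)) : Option Entry :=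
  open Classical in (bdyAt Γ a).find? fun n =>
    decide (n.dim.toTerm.sem (assign (namesAt Γ a) ψ) = fun _ => Four.const n.side)

/-- The normal form of an interpreted cell. -/
noncomputable def nf (Γ : CellCtx) {V : Type} (a : ℕ) (ψ : List (V → Four)) :
    ℕ × List (V → Four) :=
  match firing Γ a ψ with
  | some n =>
    if n.cell.head < a then
      nf Γ n.cell.head (n.cell.args.map (DTerm.sem (assign (namesAt Γ a) ψ)))
    -- A default that only secures termination: in a cell context, the heads in the boundary of `a`
    -- are smaller than `a`.
    else (a, ψ)
  | none => (a, ψ)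
termination_by a

/-- The interpretation of variables by themselves. -/
def gen (x : DVar) (v : DVar → Four) : Four := v x

theorem dmEq_iff_sem {r s : DTerm} : DMEq r s ↔ r.sem gen = s.sem gen :=
  dmEq_iff_val.trans ⟨fun h => funext h, fun h v => congrFun h v⟩

/-- The normal form of a cell in the free De Morgan algebra. -/
noncomputable def Cell.nf (Γ : CellCtx) (t : Cell) : ℕ × List ((DVar → Four) → Four) :=
  Cubical.nf Γ t.head (t.args.map (DTerm.sem gen))

/-- By completeness, the semantic condition in `firing` is the premise of the rule `CellEq.boundary`
over a consistent context. -/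
theorem fires_iff {Γ : CellCtx} {a : ℕ} {d : Decl} (hd : Γ[a]? = some d) (ψ : List DTerm)
    (n : Entry) :
    n.dim.toTerm.sem (assign (namesAt Γ a) (ψ.map (DTerm.sem gen))) =
        (fun _ => Four.const n.side) ↔
      DMEq (n.dim.toTerm.bind (contortionMap d.ctx ψ)) (.const n.side) := by
  rw [dmEq_iff_sem, DTerm.sem_bind]
  simp only [namesAt, hd, Option.map_some, Option.getD_some, funext (assign_map_sem gen d.ctx ψ)]
  rfl

theorem Cell.nf_of_firing {Γ : CellCtx} {a : ℕ} {d : Decl} (hd : Γ[a]? = some d)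
    {ψ : List DTerm} {n : Entry} (hn : firing Γ a (ψ.map (DTerm.sem gen)) = some n)
    (hlt : n.cell.head < a) :
    Cell.nf Γ ⟨a, ψ⟩ = Cell.nf Γ (n.cell.bind (contortionMap d.ctx ψ)) := by
  rw [Cell.nf, Cubical.nf, hn]
  simp only [hlt, if_true, Cell.nf, Cell.bind, List.map_map]
  congr 2
  funext r
  simp only [Function.comp, DTerm.sem_bind, namesAt, hd, Option.map_some, Option.getD_some,
    funext (assign_map_sem gen d.ctx ψ)]

theorem getElem?_of_take {Γ : CellCtx} {k a : ℕ} {d : Decl} (h : (Γ.take k)[a]? = some d) :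
    a < k ∧ Γ[a]? = some d := by
  rw [List.getElem?_take] at h
  split at h
  · exact ⟨‹_›, h⟩
  · cases h

theorem IsCell.head_lt {Γ : CellCtx} {k : ℕ} {Ψ : DCtx} {t : Cell} (h : IsCell (Γ.take k) Ψ t) :
    t.head < k :=
  let ⟨_, hd, _⟩ := h
  (getElem?_of_take hd).1

theorem IsContortion.ne_bot {l : List DVar} {Ψ : DCtx} {ψ : List DTerm}
    (h : IsContortion (.vars l) Ψ ψ) : Ψ ≠ .bot := by
  rintro rfl
  cases h.1

theorem firing_eq_some {Γ : CellCtx} {V : Type} {a : ℕ} {d : Decl} (hd : Γ[a]? = some d)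
    {ψ : List (V → Four)} {n : Entry} (h : firing Γ a ψ = some n) :
    n ∈ d.bdy ∧ n.dim.toTerm.sem (assign (namesAt Γ a) ψ) = fun _ => Four.const n.side := by
  have hb : bdyAt Γ a = d.bdy := by simp [bdyAt, hd]
  rw [firing, hb] at h
  exact ⟨List.mem_of_find?_eq_some h, by simpa using List.find?_some h⟩

/-- Equal cells have the same normal form. -/
theorem CellEq.nf_eq {Γ : CellCtx} (hΓ : IsCellCtx Γ) {l : List DVar} {k : ℕ} :
    ∀ {t u}, CellEq (Γ.take k) (.vars l) t u → t.nf Γ = u.nf Γ := by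
  -- Induction on the length of the prefix of `Γ`: if two entries of the boundary of `a` apply,
  -- their cells are equal already over the declarations before `a`.
  induction k using Nat.strong_induction_on with
  | _ k IH =>
  intro t u h
  induction h with
  | refl => rfl
  | symm _ ih => exact ih.symm
  | trans _ _ ih₁ ih₂ => exact ih₁.trans ih₂
  | args h₁ h₂ h =>
    clear h₁ h₂
    simp only [Cell.nf]
    congr 1
    induction h with
    | nil => rfl
    | cons h _ ih =>
      simp only [List.map_cons, ih, dmEq_iff_sem.1 (h.resolve_left (by simp))]
  | @boundary a d n ψ ha hn hψ hr =>
    obtain ⟨hak, hd⟩ := getElem?_of_take ha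
    have hb := hΓ.isBdy_take a d hd
    have hr := hr.resolve_left (by simp)
    have hbot := hψ.ne_bot
    cases hf : firing Γ a (ψ.map (DTerm.sem gen)) with
    | none =>
      have hb' : bdyAt Γ a = d.bdy := by simp [bdyAt, hd]
      rw [firing, hb', List.find?_eq_none] at hf
      exact absurd ((fires_iff hd ψ n).2 hr) (by simpa using hf n hn)
    | some n₀ =>
      obtain ⟨hn₀, hr₀⟩ := firing_eq_some hd hf
      rw [Cell.nf_of_firing hd hf (hb.isCell n₀ hn₀).2.head_lt]
      exact IH a hak (hb.cellEq_of_fires hbot hψ.contortionMap_over n₀ hn₀ n hn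
        ((fires_iff hd ψ n₀).1 hr₀) hr)
  | bot h => cases h

/-- Every cell is equal to one in normal form. -/
theorem IsCell.exists_cellEq_nf {Γ : CellCtx} (hΓ : IsCellCtx Γ) {l : List DVar} (a : ℕ) :
    ∀ ψ, IsCell Γ (.vars l) ⟨a, ψ⟩ → ∃ t, IsCell Γ (.vars l) t ∧ CellEq Γ (.vars l) ⟨a, ψ⟩ t ∧
      Cell.nf Γ ⟨a, ψ⟩ = (t.head, t.args.map (DTerm.sem gen)) := by
  induction a using Nat.strong_induction_on with
  | _ a IH =>
  intro ψ h
  obtain ⟨d, hd, hψ⟩ := h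
  have hb := hΓ.isBdy_take a d hd
  cases hf : firing Γ a (ψ.map (DTerm.sem gen)) with
  | none =>
    refine ⟨⟨a, ψ⟩, ⟨d, hd, hψ⟩, .refl ⟨d, hd, hψ⟩, ?_⟩
    rw [Cell.nf, Cubical.nf, hf]
  | some n =>
    obtain ⟨hn, hr⟩ := firing_eq_some hd hf
    have hr := (fires_iff hd ψ n).1 hr
    have hc := (hb.isCell n hn).2
    rw [Cell.nf_of_firing hd hf hc.head_lt]
    have hc' : IsCell Γ (.vars l) (n.cell.bind (contortionMap d.ctx ψ)) :=
      (hc.mono fun _ _ h => (getElem?_of_take h).2).bind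
        (fun x _ => hψ.contortionMap_over x)
        fun h => absurd h (DCtx.con_ne_bot hψ.ne_bot hr)
    obtain ⟨t, h1, h2, h3⟩ := IH n.cell.head hc.head_lt _ hc'
    exact ⟨t, h1, .trans (.boundary hd hn hψ (Or.inr hr)) h2, h3⟩

/-- For the converse, both cells are equal to cells in normal form; these have the same head and
pairwise equal arguments, so the rule `args` applies. -/
theorem cellEq_iff_nf {Γ : CellCtx} (hΓ : IsCellCtx Γ) {l : List DVar} {t u : Cell}
    (ht : IsCell Γ (.vars l) t) (hu : IsCell Γ (.vars l) u) :
    CellEq Γ (.vars l) t u ↔ t.nf Γ = u.nf Γ := by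
  refine ⟨fun h => CellEq.nf_eq hΓ (k := Γ.length) (by rwa [List.take_length]), fun h => ?_⟩
  obtain ⟨⟨a, ψ⟩, h1, h2, h3⟩ := IsCell.exists_cellEq_nf hΓ _ _ ht
  obtain ⟨⟨b, χ⟩, h1', h2', h3'⟩ := IsCell.exists_cellEq_nf hΓ _ _ hu
  have h := h3.symm.trans (h.trans h3')
  simp only [Prod.mk.injEq] at h
  obtain ⟨rfl, h⟩ := h
  refine .trans h2 (.trans (.args h1 h1' ?_) (.symm h2'))
  have := List.forall₂_eq_eq_eq.symm ▸ h
  rw [List.forall₂_map_left_iff, List.forall₂_map_right_iff] at this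
  exact this.imp fun r s h => Or.inr (dmEq_iff_sem.2 h)

/-! ### Equality with a cell in few variables

A cell of which the contortion involves only few variables is compared with an arbitrary cell by
means of the valuations that take a single value on all other variables. -/

/-- The order on `Four` is the product order, not the lattice order of the De Morgan algebra.
Negation exchanges the components, and joins and meets combine them by `||` and `&&`, all of which
is monotone. -/
theorem DTerm.val_mono (r : DTerm) : Monotone fun v : DVar → Four => r.val v := by
  intro v w h
  induction r with
  | var x => exact h x
  | const e => exact le_rfl
  | neg r ih => exact ⟨ih.2, ih.1⟩
  | join r s ihr ihs => exact ⟨sup_le_sup ihr.1 ihs.1, inf_le_inf ihr.2 ihs.2⟩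
  | meet r s ihr ihs => exact ⟨inf_le_inf ihr.1 ihs.1, sup_le_sup ihr.2 ihs.2⟩

/-- A function that depends only on variables in `X` is equal to a monotone function if they
agree on the valuations that are constant on the other variables. -/
theorem eq_of_comp_eq {C : Type} {c : DVar → C} {X : Set DVar}
    (hc : ∀ x ∈ X, ∀ y, c x = c y → x = y) {f g : (DVar → Four) → Four} (hf : Monotone f)
    (hg : ∀ v w, (∀ x ∈ X, v x = w x) → g v = g w)
    (h : ∀ w : C → Four, f (w ∘ c) = g (w ∘ c)) : f = g := by
  classical
  funext v
  -- The valuation `w b` follows `v` on the classes of elements of `X` and is `b` on the others. As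
  -- `c` separates the elements of `X`, pulling it back gives exactly `v` on `X`.
  let w (b : Four) (γ : C) : Four := if h : ∃ x ∈ X, c x = γ then v h.choose else b
  have hX : ∀ b, ∀ x ∈ X, (w b ∘ c) x = v x := by
    intro b x hx
    have h : ∃ y ∈ X, c y = c x := ⟨x, hx, rfl⟩
    simp only [w, Function.comp, dif_pos h]
    rw [hc _ h.choose_spec.1 x h.choose_spec.2]
  have hn : ∀ b, ∀ x, x ∉ X → (w b ∘ c) x = b := by
    intro b x hx
    have h : ¬ ∃ y ∈ X, c y = c x := fun ⟨y, hy, hyx⟩ => hx (hc y hy x hyx ▸ hy)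
    simp only [w, Function.comp, dif_neg h]
  have hv : ∀ b, f (w b ∘ c) = g v := fun b => (h _).trans (hg _ _ (hX b))
  -- At the fillings by the least and by the greatest element of `Four` the value of `f` is `g v`,
  -- and `v` lies between these fillings.
  refine le_antisymm ?_ ?_
  · rw [← hv (true, true)]
    refine hf fun x => ?_
    by_cases hx : x ∈ X
    · rw [hX _ x hx]
    · rw [hn _ x hx]
      exact ⟨Bool.le_true _, Bool.le_true _⟩
  · rw [← hv (false, false)]
    refine hf fun x => ?_
    by_cases hx : x ∈ X
    · rw [hX _ x hx]
    · rw [hn _ x hx]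
      exact ⟨Bool.false_le _, Bool.false_le _⟩

/-- A property of functions to `Four` preserved by the operations of De Morgan algebras. -/
structure IsClosed {V : Type} (P : (V → Four) → Prop) : Prop where
  const : ∀ e, P fun _ => Four.const e
  sem : ∀ (ρ : DVar → V → Four) (r : DTerm), (∀ x, P (ρ x)) → P (r.sem ρ)

theorem isClosed_monotone {V : Type} [Preorder V] : IsClosed (Monotone (α := V) (β := Four)) where
  const _ := monotone_const
  sem _ r hρ _ _ h := r.val_mono fun x => hρ x h

theorem isClosed_dependsOn (X : Set DVar) :
    IsClosed fun f : (DVar → Four) → Four => ∀ v w, (∀ x ∈ X, v x = w x) → f v = f w where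
  const _ _ _ _ := rfl
  sem _ r hρ v w h := congrArg r.val (funext fun x => hρ x v w h)

theorem IsClosed.assign {V : Type} {P : (V → Four) → Prop} (hP : IsClosed P) (l : List DVar)
    {ψ : List (V → Four)} (hψ : ∀ f ∈ ψ, P f) (x : DVar) : P (assign l ψ x) := by
  induction l generalizing ψ with
  | nil => exact hP.const false
  | cons y l ih =>
    cases ψ with
    | nil => exact hP.const false
    | cons r ψ =>
      simp only [Cubical.assign]
      split
      · exact hψ r (by simp)
      · exact ih fun s hs => hψ s (by simp [hs])

theorem IsClosed.nf {V : Type} {P : (V → Four) → Prop} (hP : IsClosed P) (Γ : CellCtx) (a : ℕ) :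
    ∀ {ψ : List (V → Four)}, (∀ f ∈ ψ, P f) → ∀ f ∈ (nf Γ a ψ).2, P f := by
  induction a using Nat.strong_induction_on with
  | _ a IH =>
  intro ψ hψ
  rw [Cubical.nf]
  split
  · split
    · refine IH _ ‹_› fun f hf => ?_
      obtain ⟨r, -, rfl⟩ := List.mem_map.1 hf
      exact hP.sem _ _ (hP.assign _ hψ)
    · exact hψ
  · exact hψ

/-- Normal forms commute with restriction along a map if this reflects constants. -/
theorem nf_map_comp {V W : Type} (h : W → V) {P : (V → Four) → Prop} (hP : IsClosed P)
    (hrefl : ∀ f e, P f → (f ∘ h = fun _ => Four.const e) → f = fun _ => Four.const e)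
    (Γ : CellCtx) (a : ℕ) : ∀ {ψ : List (V → Four)}, (∀ f ∈ ψ, P f) →
      nf Γ a (ψ.map (· ∘ h)) = ((nf Γ a ψ).1, (nf Γ a ψ).2.map (· ∘ h)) := by
  induction a using Nat.strong_induction_on with
  | _ a IH =>
  intro ψ hψ
  have hsem : ∀ r : DTerm, r.sem (assign (namesAt Γ a) (ψ.map (· ∘ h))) =
      r.sem (assign (namesAt Γ a) ψ) ∘ h := by
    intro r
    rw [funext (assign_map_comp h (namesAt Γ a) ψ)]
    rfl
  have hf : firing Γ a (ψ.map (· ∘ h)) = firing Γ a ψ := by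
    unfold firing
    congr 1
    funext n
    congr 1
    rw [hsem, eq_iff_iff]
    exact ⟨hrefl _ _ (hP.sem _ _ (hP.assign _ hψ)), fun h => by rw [h]; rfl⟩
  rw [nf, nf, hf]
  cases firing Γ a ψ with
  | none => rfl
  | some n =>
    simp only
    split
    · rename_i hlt
      rw [← IH _ hlt, List.map_map]
      · simp only [Function.comp_def (fun f => f ∘ h), ← hsem]
      · intro f hf
        obtain ⟨r, -, rfl⟩ := List.mem_map.1 hf
        exact hP.sem _ _ (hP.assign _ hψ)
    · rfl

/-- Variables interpreted by their classes. -/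
def cls {C : Type} (c : DVar → C) (x : DVar) (w : C → Four) : Four := w (c x)

theorem monotone_sem_gen (r : DTerm) : Monotone (r.sem gen) := r.val_mono

/-- To compare a cell with a cell that involves only variables in `X`, it suffices to interpret
the other variables by their classes, of which there may be few. -/
theorem nf_eq_iff (Γ : CellCtx) {C : Type} {c : DVar → C} {X : Set DVar}
    (hc : ∀ x ∈ X, ∀ y, c x = c y → x = y) {t u : Cell}
    (hu : ∀ r ∈ u.args, ∀ v w : DVar → Four, (∀ x ∈ X, v x = w x) → r.val v = r.val w) :
    t.nf Γ = u.nf Γ ↔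
      nf Γ t.head (t.args.map (DTerm.sem (cls c))) =
        nf Γ u.head (u.args.map (DTerm.sem (cls c))) := by
  let pull (w : C → Four) : DVar → Four := w ∘ c
  have hmono : ∀ t : Cell, ∀ f ∈ t.args.map (DTerm.sem gen), Monotone f := by
    intro t f hf
    obtain ⟨r, -, rfl⟩ := List.mem_map.1 hf
    exact monotone_sem_gen r
  have hcomp : ∀ t : Cell, nf Γ t.head (t.args.map (DTerm.sem (cls c))) =
      ((t.nf Γ).1, (t.nf Γ).2.map (· ∘ pull)) := by
    intro t
    rw [Cell.nf, ← nf_map_comp pull isClosed_monotone _ Γ t.head (hmono t), List.map_map]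
    · rfl
    · intro f e hf h
      -- A constant function depends on no variable, so `X = ∅` suffices. Hence the same entries
      -- apply in the interpretation by classes and in the free algebra.
      exact eq_of_comp_eq (c := c) (X := ∅) (by simp) hf (by simp) fun w => congrFun h w
  rw [hcomp, hcomp]
  refine ⟨fun h => by rw [h], fun h => ?_⟩
  simp only [Prod.mk.injEq] at h
  refine Prod.ext h.1 ?_
  have h2 := h.2
  rw [← List.forall₂_eq_eq_eq, List.forall₂_map_left_iff, List.forall₂_map_right_iff] at h2
  rw [← List.forall₂_eq_eq_eq]
  -- Both properties survive normalization: the arguments on the side of `t` stay monotone, those on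
  -- the side of `u` still depend on `X` only.
  have h3 := isClosed_monotone.nf Γ t.head (hmono t)
  have h4 := (isClosed_dependsOn X).nf Γ u.head (ψ := u.args.map (DTerm.sem gen)) (by
    intro f hf
    obtain ⟨r, hr, rfl⟩ := List.mem_map.1 hf
    exact hu r hr)
  rw [List.forall₂_iff_get] at h2 ⊢
  refine ⟨h2.1, fun i h₁ h₂ => ?_⟩
  exact eq_of_comp_eq hc (h3 _ (List.get_mem _ _)) (h4 _ (List.get_mem _ _)) fun w =>
    congrFun (h2.2 i h₁ h₂) w

/-! ### Cartesian cells -/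

/-- The cartesian cell with variable `a` given by a long enough sequence of atomic terms. -/
def cartesianCell (Γ : CellCtx) {K : ℕ} (a : ℕ) (α : Fin K → Atom) : Cell :=
  ⟨a, ((List.ofFn α).take (namesAt Γ a).length).map Atom.toTerm⟩

theorem namesAt_eq {Γ : CellCtx} {a : ℕ} {d : Decl} (hd : Γ[a]? = some d) :
    namesAt Γ a = d.ctx.names := by
  simp [namesAt, hd]

/-- Neither `⊥` nor the empty context has names, but contortions into `⊥` exist only from `⊥`; this
distinction is left to `hΨ`. -/
theorem isCell_cartesianCell {Γ : CellCtx} {K : ℕ} {a : ℕ} {d : Decl} (hd : Γ[a]? = some d)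
    (hK : (namesAt Γ a).length ≤ K) {Ψ : DCtx} (hΨ : Ψ = .bot ∨ d.ctx ≠ .bot)
    {α : Fin K → Atom} (hα : ∀ j, (α j).Over Ψ) : IsCell Γ Ψ (cartesianCell Γ a α) := by
  refine ⟨d, hd, ?_⟩
  rw [namesAt_eq hd] at hK
  simp only [cartesianCell, namesAt_eq hd]
  rcases hc : d.ctx with l | _
  · rw [hc] at hK
    refine ⟨by simpa [DCtx.names] using hK, fun r hr => ?_⟩
    obtain ⟨s, hs, rfl⟩ := List.mem_map.1 hr
    obtain ⟨j, rfl⟩ := List.mem_ofFn.1 (List.mem_of_mem_take hs)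
    exact hα j
  · exact ⟨hΨ.resolve_right (by simp [hc]), by simp [DCtx.names]⟩

/-- A sequence of atomic terms solves a boundary problem for some cell variable. -/
def Solves {Γ : CellCtx} (P : BoundaryProblem Γ) {K : ℕ} (α : Fin K → Atom) : Prop :=
  ∃ a d, Γ[a]? = some d ∧ (P.ctx = .bot ∨ d.ctx ≠ .bot) ∧
    Agrees Γ P.ctx (cartesianCell Γ a α) P.bdy

theorem exists_atom {r : DTerm} (h : r.IsCartesian) : ∃ s : Atom, s.toTerm = r := by
  cases r with
  | var x => exact ⟨.var x, rfl⟩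
  | const e => exact ⟨.const e, rfl⟩
  | neg => exact h.elim
  | join => exact h.elim
  | meet => exact h.elim

/-- Contortions into different contexts have different lengths. Padding them to the common length
`K` allows one search to serve all cell variables. -/
theorem cartesianSolvable_iff {Γ : CellCtx} (P : BoundaryProblem Γ) {K : ℕ}
    (hK : ∀ a, (namesAt Γ a).length ≤ K) :
    CartesianSolvable P ↔ ∃ α : Fin K → Atom, (∀ j, (α j).Over P.ctx) ∧ Solves P α := by
  constructor
  · rintro ⟨a, d, ψ, hd, ⟨hψ, hc⟩, -, h⟩
    have hΨ : P.ctx = .bot ∨ d.ctx ≠ .bot := by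
      rcases hd' : d.ctx with l | _
      · simp
      · rw [hd'] at hψ
        exact Or.inl hψ.1
    have hlen : ψ.length = (namesAt Γ a).length := by
      rw [namesAt_eq hd]
      rcases hd' : d.ctx with l | _
      · rw [hd'] at hψ
        exact hψ.1
      · rw [hd'] at hψ
        simp [hψ.2, DCtx.names]
    have hover : ∀ r ∈ ψ, r.Over P.ctx := by
      rcases hd' : d.ctx with l | _
      · rw [hd'] at hψ
        exact hψ.2
      · rw [hd'] at hψ
        simp [hψ.2]
    -- Positions beyond the length of `ψ` are filled with the endpoint 0; `cartesianCell` cuts them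
    -- off again.
    let α (j : Fin K) : Atom := ((ψ[j.1]?).map DTerm.toAtom).getD (.const false)
    have hα : ∀ j : Fin K, ∀ r, ψ[j.1]? = some r → (α j).toTerm = r := by
      intro j r hr
      obtain ⟨s, rfl⟩ := exists_atom (hc r (List.mem_of_getElem? hr))
      simp [α, hr, toAtom_toTerm]
    have hcell : cartesianCell Γ a α = ⟨a, ψ⟩ := by
      simp only [cartesianCell, Cell.mk.injEq, true_and]
      apply List.ext_getElem?
      intro i
      rw [← hlen]
      have hKa := hK a
      by_cases hi : i < ψ.length
      · have hiK : i < K := by omega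
        rw [List.getElem?_map, List.getElem?_take_of_lt hi,
          List.getElem?_eq_getElem (by simpa using hiK), List.getElem_ofFn, Option.map_some,
          hα ⟨i, hiK⟩ _ (List.getElem?_eq_getElem hi), List.getElem?_eq_getElem hi]
      · rw [List.getElem?_eq_none (by simp; omega), List.getElem?_eq_none (by omega)]
    refine ⟨α, fun j => ?_, a, d, hd, hΨ, by rwa [hcell]⟩
    cases hr : ψ[j.1]? with
    | none => simp [α, hr, Atom.Over, Atom.toTerm, DTerm.Over]
    | some r =>
      rw [Atom.Over, hα j r hr]
      exact hover r (List.mem_of_getElem? hr)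
  · rintro ⟨α, hα, a, d, hd, hΨ, h⟩
    obtain ⟨d', hd', hc⟩ := isCell_cartesianCell hd (hK a) hΨ hα
    obtain rfl : d = d' := Option.some.inj (hd.symm.trans hd')
    refine ⟨a, d, (cartesianCell Γ a α).args, hd, ⟨hc, fun r hr => ?_⟩, ⟨d, hd, hc⟩, h⟩
    obtain ⟨s, -, rfl⟩ := List.mem_map.1 hr
    cases s <;> trivial

theorem conSubst_over {l : List DVar} {r : Atom} {e : Bool} (x : DVar)
    (hx : (DCtx.vars l).Mem x) : ((conSubst r e x).toTerm).Over ((DCtx.vars l).con r e) := by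
  rcases r with i | b
  · simp only [conSubst]
    split
    · trivial
    · exact (List.mem_erase_of_ne ‹_›).2 hx
  · simp only [conSubst]
    split
    · rename_i hb
      rw [DCtx.con, if_pos hb]
      exact hx
    · trivial

/-! ### The finite test for a boundary entry -/

/-- Classes of variables: the positions in a sequence at which a variable occurs. -/
abbrev Cls (K : ℕ) := Fin K → Bool

/-- The finite De Morgan algebra in which dimension terms are evaluated. -/
abbrev MVal (K : ℕ) := (Cls K → Four) → Four

def mconst {K : ℕ} (e : Bool) : MVal K := fun _ => Four.const e

def mvar {K : ℕ} (c : Cls K) : MVal K := fun w => w c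

/-- Together with the next two lemmas: the value of an atomic term in the finite algebra determines
which endpoint it is, or else the class of the variable. This is all the test needs to know about a
dimension term. -/
theorem mconst_injective {K : ℕ} : Function.Injective (mconst (K := K)) := by
  intro e e' h
  have := congrFun h fun _ => (true, true)
  simpa [mconst, Four.const] using this

theorem mvar_injective {K : ℕ} : Function.Injective (mvar (K := K)) := by
  intro c c' h
  have := congrFun h fun d => (decide (d = c), true)
  simpa [mvar, eq_comm] using this

theorem mconst_ne_mvar {K : ℕ} (e : Bool) (c : Cls K) : mconst e ≠ mvar c := by
  intro h
  have := congrFun h fun _ => (true, true)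
  cases e <;> simp [mvar, mconst, Four.const] at this

/-- The sequence of atomic terms given by constants `κ` and variables `τ`. -/
def atoms {K : ℕ} (κ : Fin K → Option Bool) (τ : Fin K → Option DVar) (j : Fin K) : Atom :=
  match κ j with
  | some e => .const e
  | none => .var ((τ j).getD [])

/-- The class of a variable. -/
def flag {K : ℕ} (τ : Fin K → Option DVar) (x : DVar) : Cls K := fun j => decide (τ j = some x)

/-- The values of a sequence of atomic terms after the class `c` has been replaced by `e`. -/
def argVal {K : ℕ} (κ : Fin K → Option Bool) (cl : Fin K → Cls K) (c : Cls K) (e : Bool)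
    (j : Fin K) : MVal K :=
  match κ j with
  | some e' => mconst e'
  | none => if c j then mconst e else mvar (cl j)

/-- Equality of a cartesian cell and a contorted cell in the finite algebra. -/
def SameCell (Γ : CellCtx) {K : ℕ} (a : ℕ) (A : Fin K → MVal K) (b : ℕ)
    (args : List (MVal K)) : Prop :=
  nf Γ a ((List.ofFn A).take (namesAt Γ a).length) = nf Γ b args

/-- The test for a boundary entry, given the values of its dimension term, side and arguments. -/
def EntryOK (Γ : CellCtx) {K : ℕ} (κ : Fin K → Option Bool) (cl : Fin K → Cls K) (a b : ℕ) :
    List (MVal K) → Prop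
  | dim :: side :: args => ∃ e, side = mconst e ∧ (dim = mconst (!e) ∨
      (dim = mconst e ∧ SameCell Γ a (argVal κ cl (fun _ => false) e) b args) ∨
      ∃ c, dim = mvar c ∧ SameCell Γ a (argVal κ cl c e) b args)
  | _ => False

/-- The value of a dimension term in the finite algebra. -/
def mval {K : ℕ} (τ : Fin K → Option DVar) (r : DTerm) : MVal K := r.sem (cls (flag τ))

/-- The boundary entry as it is read by the test. -/
def Entry.mvals {K : ℕ} (τ : Fin K → Option DVar) (n : Entry) : List (MVal K) :=
  mval τ n.dim.toTerm :: mconst n.side :: n.cell.args.map (mval τ)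

/-- An instance of `nf_eq_iff`, with `X` the variables at positions without a constant; occurring at
such a position distinguishes a variable from all others. A variable left in `τ` at a constant
position can only refine the classes. By `hs`, the substituted cell still involves variables in `X`
only. -/
theorem sameCell_iff {Γ : CellCtx} (hΓ : IsCellCtx Γ) {K : ℕ} {κ : Fin K → Option Bool}
    {τ : Fin K → Option DVar} (hτ : ∀ j, κ j = none → (τ j).isSome) {l : List DVar} {a : ℕ}
    {t : Cell} {s : DVar → Atom} (hs : ∀ x y, s x = .var y → y = x)
    (hu : IsCell Γ (.vars l) ((cartesianCell Γ a (atoms κ τ)).subst s))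
    (ht : IsCell Γ (.vars l) t) {A : Fin K → MVal K}
    (hA : ∀ j, A j = mval τ ((atoms κ τ j).subst s).toTerm) :
    SameCell Γ a A t.head (t.args.map (mval τ)) ↔
      CellEq Γ (.vars l) ((cartesianCell Γ a (atoms κ τ)).subst s) t := by
  have hargs : ((cartesianCell Γ a (atoms κ τ)).subst s).args =
      ((List.ofFn fun j => (atoms κ τ j).subst s).take (namesAt Γ a).length).map
        Atom.toTerm := by
    simp only [Cell.subst, Cell.bind, cartesianCell, ← Atom.toTerm_subst,
      Function.comp_def, List.map_take, List.map_ofFn]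
  rw [cellEq_iff_nf hΓ hu ht, eq_comm, nf_eq_iff Γ (c := flag τ)
    (X := {x | ∃ j, κ j = none ∧ τ j = some x})]
  · rw [hargs, eq_comm, SameCell]
    have : (List.ofFn A).take (namesAt Γ a).length =
        (((List.ofFn fun j => (atoms κ τ j).subst s).take (namesAt Γ a).length).map
          Atom.toTerm).map (DTerm.sem (cls (flag τ))) := by
      rw [List.map_map, List.map_take, List.map_ofFn]
      congr 2
      funext j
      exact hA j
    rw [this]
    rfl
  · rintro x ⟨j, -, hj⟩ y hxy
    have := congrFun hxy j
    simp only [flag, hj, decide_true] at this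
    simpa using this.symm
  · rw [hargs]
    intro r hr v w hvw
    obtain ⟨r, hr', rfl⟩ := List.mem_map.1 hr
    obtain ⟨j, rfl⟩ := List.mem_ofFn.1 (List.mem_of_mem_take hr')
    cases hκ : κ j with
    | some e => simp [atoms, hκ, Atom.subst, Atom.toTerm, DTerm.val]
    | none =>
      obtain ⟨x, hx⟩ := Option.isSome_iff_exists.1 (hτ j hκ)
      simp only [atoms, hκ, hx, Option.getD_some, Atom.subst]
      cases hsx : s x with
      | const e => rfl
      | var y =>
        obtain rfl := hs x y hsx
        exact hvw y ⟨j, hκ, hx⟩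

/-- The finite test decides agreement with a boundary entry. -/
theorem entryOK_iff {Γ : CellCtx} (hΓ : IsCellCtx Γ) {K : ℕ} {κ : Fin K → Option Bool}
    {τ : Fin K → Option DVar} (hτ : ∀ j, κ j = none → (τ j).isSome) {l : List DVar}
    {cl : Fin K → Cls K} (hcl : ∀ j x, κ j = none → τ j = some x → cl j = flag τ x) {a : ℕ}
    (hu : IsCell Γ (.vars l) (cartesianCell Γ a (atoms κ τ))) {n : Entry}
    (hn : IsCell Γ ((DCtx.vars l).con n.dim n.side) n.cell) :
    EntryOK Γ κ cl a n.cell.head (n.mvals τ) ↔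
      CellEq Γ ((DCtx.vars l).con n.dim n.side)
        ((cartesianCell Γ a (atoms κ τ)).subst (conSubst n.dim n.side)) n.cell := by
  obtain ⟨r, e, t⟩ := n
  simp only at hn ⊢
  have hu' : IsCell Γ ((DCtx.vars l).con r e)
      ((cartesianCell Γ a (atoms κ τ)).subst (conSubst r e)) :=
    hu.bind (fun x hx => conSubst_over x hx) fun h => by cases h
  simp only [Entry.mvals, EntryOK, mconst_injective.eq_iff, exists_eq_left']
  rcases r with i | b
  · have h1 : mval τ (Atom.var i).toTerm = mvar (flag τ i) := rfl
    simp only [h1, (mconst_ne_mvar _ _).symm, false_and, false_or, mvar_injective.eq_iff,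
      exists_eq_left']
    -- Setting `i` to `e` replaces, among the positions without a constant, exactly those in the
    -- class of `i`: none if the candidate does not use `i`.
    refine sameCell_iff hΓ hτ ?_ hu' hn fun j => ?_
    · intro x y h
      simp only [conSubst] at h
      split at h
      · cases h
      · cases h
        rfl
    · cases hκ : κ j with
      | some e => simp only [argVal, hκ, atoms]; rfl
      | none =>
        obtain ⟨x, hx⟩ := Option.isSome_iff_exists.1 (hτ j hκ)
        simp only [argVal, hκ, atoms, hx, Option.getD_some, Atom.subst, flag, Option.some.injEq,
          decide_eq_true_eq, conSubst, hcl j x hκ hx]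
        split <;> rfl
  · have h1 : mval τ (Atom.const b).toTerm = mconst b := rfl
    simp only [h1, mconst_injective.eq_iff, mconst_ne_mvar, false_and, exists_false, or_false]
    by_cases hb : b = e
    · subst hb
      simp only [true_and, Bool.eq_not_self, false_or]
      have hcon : (DCtx.vars l).con (.const b) b = .vars l := by simp [DCtx.con]
      rw [hcon] at hn hu' ⊢
      refine sameCell_iff hΓ hτ ?_ hu' hn fun j => ?_
      · intro x y h
        simp only [conSubst, if_true] at h
        cases h
        rfl
      · cases hκ : κ j with
        | some e => simp only [argVal, hκ, atoms]; rfl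
        | none =>
          obtain ⟨x, hx⟩ := Option.isSome_iff_exists.1 (hτ j hκ)
          simp only [argVal, hκ, atoms, hx, Option.getD_some, Atom.subst, conSubst,
            hcl j x hκ hx, Bool.false_eq_true, if_false, if_true]
          rfl
    · obtain rfl : b = !e := by
        revert hb
        cases b <;> cases e <;> decide
      have hcon : (DCtx.vars l).con (.const (!e)) e = .bot := if_neg hb
      rw [hcon] at hn hu' ⊢
      -- Over `⊥` all cells are equal, and the test accepts by its first alternative.
      exact iff_of_true (Or.inl rfl) (.bot rfl hu' hn)

/-! ### Structured programs for multi-stack machines -/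

section Programs

variable {K : Type} (Γ : K → Type) (σ : Type)

/-- Structured programs on stacks with alphabets `Γ` and a register with values in `σ`. -/
inductive Prog
  | push (k : K) (f : σ → Γ k)
  | pop (k : K) (f : σ → Option (Γ k) → σ)
  | peek (k : K) (f : σ → Option (Γ k) → σ)
  | load (f : σ → σ)
  | seq (P Q : Prog)
  | ite (p : σ → Bool) (P Q : Prog)
  | loop (p : σ → Bool) (P : Prog)

abbrev Store := σ × ∀ k, List (Γ k)

variable {Γ σ} [DecidableEq K]

/-- `Exec P s s' t`: the program `P` takes the store `s` to the store `s'` in `t` steps. -/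
inductive Exec : Prog Γ σ → Store Γ σ → Store Γ σ → ℕ → Prop
  | push (k f v S) : Exec (.push k f) (v, S) (v, Function.update S k (f v :: S k)) 1
  | pop (k f v S) : Exec (.pop k f) (v, S) (f v (S k).head?, Function.update S k (S k).tail) 1
  | peek (k f v S) : Exec (.peek k f) (v, S) (f v (S k).head?, S) 1
  | load (f v S) : Exec (.load f) (v, S) (f v, S) 1
  | seq {P Q s s' s'' t t'} : Exec P s s' t → Exec Q s' s'' t' → Exec (.seq P Q) s s'' (t + t')
  | ite_true {p P Q s s' t} : p s.1 = true → Exec P s s' t → Exec (.ite p P Q) s s' (1 + t)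
  | ite_false {p P Q s s' t} : p s.1 = false → Exec Q s s' t → Exec (.ite p P Q) s s' (1 + t)
  | loop_true {p P s s' s'' t t'} : p s.1 = true → Exec P s s' t →
      Exec (.loop p P) s' s'' t' → Exec (.loop p P) s s'' (1 + t + t')
  | loop_false {p P s} : p s.1 = false → Exec (.loop p P) s s 1

/-- The program points of a program. -/
def Prog.Label : Prog Γ σ → Type
  | .push _ _ => Unit
  | .pop _ _ => Unit
  | .peek _ _ => Unit
  | .load _ => Unit
  | .seq P Q => P.Label ⊕ Q.Label
  | .ite _ P Q => Option (P.Label ⊕ Q.Label)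
  | .loop _ P => Option P.Label

instance Prog.finiteLabel (P : Prog Γ σ) : Finite P.Label := by
  induction P with
  | push => exact inferInstanceAs (Finite Unit)
  | pop => exact inferInstanceAs (Finite Unit)
  | peek => exact inferInstanceAs (Finite Unit)
  | load => exact inferInstanceAs (Finite Unit)
  | seq P Q _ _ => exact inferInstanceAs (Finite (P.Label ⊕ Q.Label))
  | ite _ P Q _ _ => exact inferInstanceAs (Finite (Option (P.Label ⊕ Q.Label)))
  | loop _ P _ => exact inferInstanceAs (Finite (Option P.Label))

def Prog.entry : (P : Prog Γ σ) → P.Label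
  | .push _ _ => ()
  | .pop _ _ => ()
  | .peek _ _ => ()
  | .load _ => ()
  | .seq P _ => .inl P.entry
  | .ite _ _ _ => none
  | .loop _ _ => none

/-! ### Compilation of structured programs -/

open Turing

/-- The statements of a machine that runs a program and then jumps to `exit`. -/
def Prog.compile {Λ : Type} : (P : Prog Γ σ) → (P.Label → Λ) → Λ → P.Label → TM2.Stmt Γ Λ σ
  | .push k f, _, exit, _ => .push k f (.goto fun _ => exit)
  | .pop k f, _, exit, _ => .pop k f (.goto fun _ => exit)
  | .peek k f, _, exit, _ => .peek k f (.goto fun _ => exit)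
  | .load f, _, exit, _ => .load f (.goto fun _ => exit)
  | .seq P Q, emb, _, .inl i => P.compile (emb ∘ .inl) (emb (.inr Q.entry)) i
  | .seq _ Q, emb, exit, .inr i => Q.compile (emb ∘ .inr) exit i
  | .ite p P Q, emb, _, none =>
    .branch p (.goto fun _ => emb (some (.inl P.entry))) (.goto fun _ => emb (some (.inr Q.entry)))
  | .ite _ P _, emb, exit, some (.inl i) => P.compile (emb ∘ some ∘ .inl) exit i
  | .ite _ _ Q, emb, exit, some (.inr i) => Q.compile (emb ∘ some ∘ .inr) exit i
  | .loop p P, emb, exit, none =>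
    .branch p (.goto fun _ => emb (some P.entry)) (.goto fun _ => exit)
  | .loop _ P, emb, _, some i => P.compile (emb ∘ some) (emb none) i

/-- The machine goes from one configuration to another in `t` steps. -/
def StepsTo {Λ : Type} (m : Λ → TM2.Stmt Γ Λ σ) (t : ℕ) (c c' : TM2.Cfg Γ Λ σ) : Prop :=
  (flip bind (TM2.step m))^[t] (some c) = some c'

theorem StepsTo.trans {Λ : Type} {m : Λ → TM2.Stmt Γ Λ σ} {t t' : ℕ} {c c' c'' : TM2.Cfg Γ Λ σ}
    (h : StepsTo m t c c') (h' : StepsTo m t' c' c'') : StepsTo m (t + t') c c'' := by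
  rw [StepsTo, Nat.add_comm, Function.iterate_add_apply, h]
  exact h'

theorem StepsTo.single {Λ : Type} {m : Λ → TM2.Stmt Γ Λ σ} {l : Λ} {v : σ} {S : ∀ k, List (Γ k)}
    {c' : TM2.Cfg Γ Λ σ} (h : TM2.stepAux (m l) v S = c') : StepsTo m 1 ⟨some l, v, S⟩ c' :=
  congrArg some h

/-- Induction on the execution. The embedding of labels and the exit are arbitrary because a
subprogram runs inside the machine of the whole program and continues where that program prescribes.
-/
theorem Exec.stepsTo {Λ : Type} {m : Λ → TM2.Stmt Γ Λ σ} {P : Prog Γ σ} {s s' : Store Γ σ} {t : ℕ}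
    (h : Exec P s s' t) : ∀ {emb : P.Label → Λ} {exit : Λ},
      (∀ i, m (emb i) = P.compile emb exit i) →
      StepsTo m t ⟨some (emb P.entry), s.1, s.2⟩ ⟨some exit, s'.1, s'.2⟩ := by
  induction h with
  | push k f v S => exact fun hm => .single (by rw [hm]; rfl)
  | pop k f v S => exact fun hm => .single (by rw [hm]; rfl)
  | peek k f v S => exact fun hm => .single (by rw [hm]; rfl)
  | load f v S => exact fun hm => .single (by rw [hm]; rfl)
  | seq _ _ ih₁ ih₂ =>
    intro emb exit hm
    exact (ih₁ (emb := emb ∘ .inl) fun i => hm (.inl i)).trans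
      (ih₂ (emb := emb ∘ .inr) fun i => hm (.inr i))
  | ite_true hp _ ih =>
    intro emb exit hm
    exact .trans (.single (by rw [hm]; simp [Prog.entry, Prog.compile, hp]; rfl))
      (ih (emb := emb ∘ some ∘ .inl) fun i => hm (some (.inl i)))
  | ite_false hp _ ih =>
    intro emb exit hm
    exact .trans (.single (by rw [hm]; simp [Prog.entry, Prog.compile, hp]; rfl))
      (ih (emb := emb ∘ some ∘ .inr) fun i => hm (some (.inr i)))
  | loop_true hp _ _ ih₁ ih₂ =>
    intro emb exit hm
    exact .trans (.trans (.single (by rw [hm]; simp [Prog.entry, Prog.compile, hp]; rfl))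
      (ih₁ (emb := emb ∘ some) fun i => hm (some i))) (ih₂ hm)
  | loop_false hp =>
    intro emb exit hm
    exact .single (by rw [hm]; simp [Prog.entry, Prog.compile, hp])

/-- `Run P s s' T`: the program `P` takes the store `s` to the store `s'` in at most `T` steps. -/
def Run (P : Prog Γ σ) (s s' : Store Γ σ) (T : ℕ) : Prop := ∃ t ≤ T, Exec P s s' t

theorem Run.mono {P : Prog Γ σ} {s s' : Store Γ σ} {T T' : ℕ} (h : Run P s s' T) (hT : T ≤ T') :
    Run P s s' T' :=
  let ⟨t, ht, h⟩ := h
  ⟨t, ht.trans hT, h⟩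

theorem Run.of {P : Prog Γ σ} {s s₁ s' : Store Γ σ} {T T' : ℕ} (h : Run P s s₁ T)
    (hs : s₁ = s') (hT : T ≤ T') : Run P s s' T' :=
  hs ▸ h.mono hT

theorem Run.push {k : K} {f : σ → Γ k} {v : σ} {S S' : ∀ k, List (Γ k)}
    (h : Function.update S k (f v :: S k) = S') : Run (.push k f) (v, S) (v, S') 1 :=
  ⟨1, le_rfl, h ▸ .push k f v S⟩

theorem Run.pop {k : K} {f : σ → Option (Γ k) → σ} {v v' : σ} {S S' : ∀ k, List (Γ k)}
    (hv : f v (S k).head? = v') (h : Function.update S k (S k).tail = S') :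
    Run (.pop k f) (v, S) (v', S') 1 :=
  ⟨1, le_rfl, h ▸ hv ▸ .pop k f v S⟩

theorem Run.peek {k : K} {f : σ → Option (Γ k) → σ} {v v' : σ} {S : ∀ k, List (Γ k)}
    (hv : f v (S k).head? = v') : Run (.peek k f) (v, S) (v', S) 1 :=
  ⟨1, le_rfl, hv ▸ .peek k f v S⟩

theorem Run.load {f : σ → σ} {v v' : σ} {S : ∀ k, List (Γ k)} (hv : f v = v') :
    Run (.load f) (v, S) (v', S) 1 :=
  ⟨1, le_rfl, hv ▸ .load f v S⟩

theorem Run.seq {P Q : Prog Γ σ} {s s' s'' : Store Γ σ} {T T' : ℕ} (h : Run P s s' T)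
    (h' : Run Q s' s'' T') : Run (.seq P Q) s s'' (T + T') :=
  let ⟨_, ht, h⟩ := h
  let ⟨_, ht', h'⟩ := h'
  ⟨_, add_le_add ht ht', h.seq h'⟩

theorem Run.ite_true {p : σ → Bool} {P Q : Prog Γ σ} {s s' : Store Γ σ} {T : ℕ}
    (hp : p s.1 = true) (h : Run P s s' T) : Run (.ite p P Q) s s' (1 + T) :=
  let ⟨_, ht, h⟩ := h
  ⟨_, Nat.add_le_add_left ht 1, .ite_true hp h⟩

theorem Run.ite_false {p : σ → Bool} {P Q : Prog Γ σ} {s s' : Store Γ σ} {T : ℕ}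
    (hp : p s.1 = false) (h : Run Q s s' T) : Run (.ite p P Q) s s' (1 + T) :=
  let ⟨_, ht, h⟩ := h
  ⟨_, Nat.add_le_add_left ht 1, .ite_false hp h⟩

theorem Run.loop_true {p : σ → Bool} {P : Prog Γ σ} {s s' s'' : Store Γ σ} {T T' : ℕ}
    (hp : p s.1 = true) (h : Run P s s' T) (h' : Run (.loop p P) s' s'' T') :
    Run (.loop p P) s s'' (1 + T + T') :=
  let ⟨_, ht, h⟩ := h
  let ⟨_, ht', h'⟩ := h'
  ⟨_, add_le_add (Nat.add_le_add_left ht 1) ht', .loop_true hp h h'⟩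

theorem Run.loop_false {p : σ → Bool} {P : Prog Γ σ} {s : Store Γ σ} (hp : p s.1 = false) :
    Run (.loop p P) s s 1 :=
  ⟨1, le_rfl, .loop_false hp⟩

/-- Pop all symbols of a stack and run `P` on each of them. -/
def Prog.pass (k : K) (set : σ → Option (Γ k) → σ) (p : σ → Bool) (P : Prog Γ σ) : Prog Γ σ :=
  .seq (.pop k set) (.loop p (.seq P (.pop k set)))

/-- The rule for a pass: `F a L x` is the store with `L` on the stack and `x` in the register. -/
theorem Run.pass {α : Type} {k : K} {set : σ → Option (Γ k) → σ} {p : σ → Bool} {P : Prog Γ σ}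
    {F : α → List (Γ k) → Option (Γ k) → Store Γ σ} {step : α → Γ k → α} {T : ℕ}
    (hset : ∀ a L x, set (F a L x).1 L.head? = (F a L.tail L.head?).1)
    (hk : ∀ a L x, (F a L x).2 k = L)
    (hupdate : ∀ a L x y, Function.update (F a L x).2 k L.tail = (F a L.tail y).2)
    (hp : ∀ a L x, p (F a L x).1 = x.isSome)
    (I : α → List (Γ k) → Prop) (hI : ∀ a x L, I a (x :: L) → I (step a x) L)
    (hP : ∀ a x L, I a (x :: L) → ∃ y, Run P (F a L (some x)) (F (step a x) L y) T)
    (L : List (Γ k)) :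
    ∀ a x a', I a L → L.foldl step a = a' → Run (.pass k set p P) (F a L x) (F a' [] none)
      ((T + 2) * L.length + 2) := by
  have hpop : ∀ a L x, Run (.pop k set) (F a L x) (F a L.tail L.head?) 1 := fun a L x =>
    Run.pop (by rw [hk, hset]) (by rw [hk]; exact hupdate a L x _)
  -- Each symbol costs one loop test, one run of `P` and one pop. The first pop and the last test
  -- account for the two additional steps.
  have key : ∀ L a, I a L → Run (.loop p (.seq P (.pop k set))) (F a L.tail L.head?)
      (F (L.foldl step a) [] none) ((T + 2) * L.length + 1) := by
    intro L
    induction L with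
    | nil => exact fun a _ => (Run.loop_false (by simp [hp])).mono (by simp)
    | cons x L ih =>
      intro a ha
      obtain ⟨y, hy⟩ := hP a x L ha
      refine (Run.loop_true (by simp [hp]) (hy.seq (hpop _ _ _))
        (ih _ (hI _ _ _ ha))).mono ?_
      rw [List.length_cons]
      ring_nf
      omega
  rintro a x _ ha rfl
  exact ((hpop a L x).seq (key L a ha)).mono (by omega)

end Programs

/-! ### The machine that searches for a cartesian contortion -/

/-- Tokens with a class; the class is used on ends of names only. -/
abbrev WTok (K : ℕ) := Tok × Cls K

/-- The working word is on `w`, and `w'` receives it in reverse during a pass. The stack `y` holds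
tokens in transit, `s` holds values of terms, and `nm j` the names still to be tried at position
`j`. -/
inductive Stk (K : ℕ) where
  | inp | out | w | w' | y | s
  | nm (j : Fin K)
  deriving DecidableEq

instance Stk.finite (K : ℕ) : Finite (Stk K) :=
  Finite.of_surjective
    (fun i : Fin 6 ⊕ Fin K => match i with
      | .inl 0 => Stk.inp
      | .inl 1 => .out
      | .inl 2 => .w
      | .inl 3 => .w'
      | .inl 4 => .y
      | .inl 5 => .s
      | .inr j => .nm j)
    fun k => match k with
      | .inp => ⟨.inl 0, rfl⟩
      | .out => ⟨.inl 1, rfl⟩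
      | .w => ⟨.inl 2, rfl⟩
      | .w' => ⟨.inl 3, rfl⟩
      | .y => ⟨.inl 4, rfl⟩
      | .s => ⟨.inl 5, rfl⟩
      | .nm j => ⟨.inr j, rfl⟩

/-- The alphabets of the stacks. -/
abbrev Alph (K : ℕ) : Stk K → Type
  | .inp => Tok
  | .out => Bool
  | .w => WTok K
  | .w' => WTok K
  | .y => Tok
  | .s => MVal K
  | .nm _ => Tok

/-- Lists of bounded length. -/
abbrev BList (A : Type) (n : ℕ) := {l : List A // l.length ≤ n}

def BList.nil {A : Type} {n : ℕ} : BList A n := ⟨[], Nat.zero_le _⟩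

/-- Addition of an element to a list of bounded length that is not full. -/
def BList.cons {A : Type} {n : ℕ} (l : BList A n) (a : A) : BList A n :=
  if h : l.1.length < n then ⟨a :: l.1, h⟩ else l

theorem BList.foldl_cons_val {A : Type} {n : ℕ} (L : List A) :
    ∀ l : BList A n, l.1.length + L.length ≤ n → (L.foldl BList.cons l).1 = L.reverse ++ l.1 := by
  induction L with
  | nil => simp
  | cons a L ih =>
    intro l h
    rw [List.length_cons] at h
    have hl : l.1.length < n := by omega
    rw [List.foldl_cons, BList.cons, dif_pos hl, ih]
    · simp
    · simp only [List.length_cons]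
      omega

/-- The part of the register used by the evaluation of boundaries. -/
structure Chk (K N : ℕ) where
  inCtx : Bool
  isBot : Bool
  cl : Fin K → Cls K
  ticks : Fin (N + 1)
  ok : Fin N → Bool
  -- Room for one entry: its dimension term, its side and at most `K` arguments.
  acc : BList (MVal K) (K + 2)

def Chk.init (K N : ℕ) : Chk K N := ⟨true, false, fun _ _ => false, 0, fun _ => true, .nil⟩

/-- Only the constants `κ` of the candidate are in the register; names are unbounded, so its
variables live as classes on the working word. The flag `b` serves the copying and the comparison of
names, and `res` collects the outcome of the search. -/
structure Reg (K N : ℕ) where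
  cur : Option (WTok K)
  x : Option Tok
  b : Bool
  κ : Fin K → Option Bool
  res : Bool
  chk : Chk K N

/-- The register between the parts of the program. -/
def Reg.base {K : ℕ} (N : ℕ) (κ : Fin K → Option Bool) (res : Bool) : Reg K N :=
  ⟨none, none, true, κ, res, .init K N⟩

instance BList.finite (A : Type) [Finite A] (n : ℕ) : Finite (BList A n) :=
  List.finite_length_le A n

instance Chk.finite (K N : ℕ) : Finite (Chk K N) :=
  Finite.of_injective
    (fun c : Chk K N => (c.inCtx, c.isBot, c.cl, c.ticks, c.ok, c.acc)) fun c c' h => by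
      cases c
      cases c'
      simpa using h

instance Reg.finite (K N : ℕ) : Finite (Reg K N) :=
  Finite.of_injective
    (fun r : Reg K N => (r.cur, r.x, r.b, r.κ, r.res, r.chk)) fun c c' h => by
      cases c
      cases c'
      simpa using h

/-- The stacks of the machine. -/
def stk {K : ℕ} (inp : List Tok) (out : List Bool) (w w' : List (WTok K)) (y : List Tok)
    (s : List (MVal K)) (nm : Fin K → List Tok) : ∀ k, List (Alph K k)
  | .inp => inp
  | .out => out
  | .w => w
  | .w' => w'
  | .y => y
  | .s => s
  | .nm j => nm j

section Stacks

variable {K : ℕ} (inp : List Tok) (out : List Bool) (w w' : List (WTok K)) (y : List Tok)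
    (s : List (MVal K)) (nm : Fin K → List Tok)

theorem update_inp (v : List Tok) : Function.update (stk inp out w w' y s nm) .inp v =
    stk v out w w' y s nm := by
  funext k; cases k <;> rfl

theorem update_out (v : List Bool) : Function.update (stk inp out w w' y s nm) .out v =
    stk inp v w w' y s nm := by
  funext k; cases k <;> rfl

theorem update_w (v : List (WTok K)) : Function.update (stk inp out w w' y s nm) .w v =
    stk inp out v w' y s nm := by
  funext k; cases k <;> rfl

theorem update_w' (v : List (WTok K)) : Function.update (stk inp out w w' y s nm) .w' v =
    stk inp out w v y s nm := by
  funext k; cases k <;> rfl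

theorem update_y (v : List Tok) : Function.update (stk inp out w w' y s nm) .y v =
    stk inp out w w' v s nm := by
  funext k; cases k <;> rfl

theorem update_s (v : List (MVal K)) : Function.update (stk inp out w w' y s nm) .s v =
    stk inp out w w' y v nm := by
  funext k; cases k <;> rfl

theorem update_nm (j : Fin K) (v : List Tok) :
    Function.update (stk inp out w w' y s nm) (.nm j) v =
      stk inp out w w' y s (Function.update nm j v) := by
  funext k
  cases k with
  | nm i =>
    by_cases h : i = j
    · subst h
      exact (Function.update_self ..).trans (Function.update_self (f := nm) ..).symm
    · exact (Function.update_of_ne (by simpa using h) ..).trans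
        (Function.update_of_ne (f := nm) h ..).symm
  | _ => rfl

end Stacks

variable {K N : ℕ}

abbrev MProg (K N : ℕ) := Prog (Alph K) (Reg K N)

def setCur (r : Reg K N) (t : Option (WTok K)) : Reg K N := { r with cur := t }

def setX (r : Reg K N) (t : Option Tok) : Reg K N := { r with x := t }

def Reg.tok (r : Reg K N) : WTok K := r.cur.getD (.sep, fun _ => false)

def Prog.skip : MProg K N := .load id

/-- Return to the base register. -/
def Prog.reset : MProg K N := .load fun r => .base N r.κ r.res

def pushTok : MProg K N := .push .w' Reg.tok

/-- Run a program on each token of the working word. -/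
def Prog.overWord (P : MProg K N) : MProg K N :=
  .pass .w setCur (fun r => r.cur.isSome) (.seq P pushTok)

/-- Move the working word back to its stack. -/
def restore : MProg K N :=
  .pass .w' setCur (fun r => r.cur.isSome) (.push .w Reg.tok)

/-- Move the auxiliary stack of tokens to the stack of names. -/
def moveNames (j : Fin K) : MProg K N :=
  .pass .y setX (fun r => r.x.isSome) (.push (.nm j) fun r => r.x.getD .sep)

theorem run_push_nm (j : Fin K) (f : Reg K N → Tok) (r : Reg K N) (inp out w w' y s nm) :
    Run (.push (.nm j) f : MProg K N) (r, stk inp out w w' y s nm)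
      (r, stk inp out w w' y s (Function.update nm j (f r :: nm j))) 1 :=
  Run.push (update_nm ..)

theorem run_restore (r : Reg K N) (inp out w w' y s nm) :
    Run restore (r, stk inp out w w' y s nm)
      (setCur r none, stk inp out (w'.reverse ++ w) [] y s nm) (3 * w'.length + 2) := by
  have h := Run.pass (k := Stk.w') (set := setCur) (p := fun r : Reg K N => r.cur.isSome)
    (P := .push .w Reg.tok) (F := fun (a : List (WTok K)) L x =>
      (setCur r x, stk inp out a L y s nm)) (step := fun a t => t :: a) (T := 1)
    (fun _ _ _ => rfl) (fun _ _ _ => rfl) (fun _ _ _ _ => update_w' ..) (fun _ _ _ => rfl)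
    (fun _ _ => True) (fun _ _ _ _ => trivial)
    (fun a x L _ => ⟨some x, Run.push (update_w ..)⟩) w' w r.cur _ trivial
    List.foldl_flip_cons_eq_append'
  exact h

theorem run_moveNames (j : Fin K) (r : Reg K N) (inp out w w' y s nm) :
    Run (moveNames j) (r, stk inp out w w' y s nm)
      (setX r none, stk inp out w w' [] s (Function.update nm j (y.reverse ++ nm j)))
      (3 * y.length + 2) := by
  have h := Run.pass (k := Stk.y) (set := setX) (p := fun r : Reg K N => r.x.isSome)
    (P := .push (.nm j) fun r => r.x.getD .sep) (F := fun (a : List Tok) L x =>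
      (setX r x, stk inp out w w' L s (Function.update nm j a))) (step := fun a t => t :: a) (T := 1)
    (fun _ _ _ => rfl) (fun _ _ _ => rfl) (fun _ _ _ _ => update_y ..) (fun _ _ _ => rfl)
    (fun _ _ => True) (fun _ _ _ _ => trivial)
    (fun a x L _ => by
      have h := run_push_nm j (fun r => r.x.getD .sep) (setX r (some x)) inp out w w' L s
        (Function.update nm j a)
      rw [Function.update_idem, Function.update_self] at h
      exact ⟨some x, h⟩)
    y (nm j) r.x _ trivial List.foldl_flip_cons_eq_append'
  rw [Function.update_eq_self] at h
  exact h

/-! ### Words with classes -/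

/-- The name that is being read after a token. -/
def nextName (u : List Bool) : Tok → List Bool
  | .bit b => u ++ [b]
  | .endName => []
  | _ => u

/-- A token together with the class of the name that it ends. -/
def annTok (τ : Fin K → Option DVar) (u : List Bool) (t : Tok) : WTok K :=
  (t, if t = .endName then flag τ u else fun _ => false)

/-- A word in which the ends of names carry classes. -/
def ann (τ : Fin K → Option DVar) : List Bool → List Tok → List (WTok K)
  | _, [] => []
  | u, t :: L => annTok τ u t :: ann τ (nextName u t) L

theorem map_fst_ann (τ : Fin K → Option DVar) (u : List Bool) (L : List Tok) :
    (ann τ u L).map Prod.fst = L := by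
  induction L generalizing u with
  | nil => rfl
  | cons t L ih => simp [ann, annTok, ih]

theorem length_ann (τ : Fin K → Option DVar) (u : List Bool) (L : List Tok) :
    (ann τ u L).length = L.length := by
  rw [← List.length_map Prod.fst, map_fst_ann]

theorem ann_none (u : List Bool) (L : List Tok) :
    ann (K := K) (fun _ => none) u L = L.map fun t => (t, fun _ => false) := by
  induction L generalizing u with
  | nil => rfl
  | cons t L ih => cases t <;> simp [ann, annTok, ih, funext_iff, flag]

/-! ### Reading the input and copying the names -/

theorem run_reset (r : Reg K N) (S : ∀ k, List (Alph K k)) :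
    Run .reset (r, S) (.base N r.κ r.res, S) 1 := Run.load rfl

theorem run_skip (s : Store (Alph K) (Reg K N)) : Run .skip s s 1 := Run.load rfl

def readInput : MProg K N :=
  .seq (.pass .inp (fun r t => { r with cur := t.map fun t => (t, fun _ => false) })
    (fun r => r.cur.isSome) pushTok) restore

theorem run_readInput (κ : Fin K → Option Bool) (res : Bool) (L : List Tok) (nm) :
    Run readInput (.base N κ res, stk L [] [] [] [] [] nm)
      (.base N κ res, stk [] [] (ann (fun _ => none) [] L) [] [] [] nm) (6 * L.length + 4) := by
  have h := Run.pass (k := Stk.inp)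
    (set := fun (r : Reg K N) (t : Option Tok) =>
      { r with cur := t.map fun t => (t, fun _ => false) })
    (p := fun r : Reg K N => r.cur.isSome) (P := pushTok)
    (F := fun (a : List (WTok K)) L (x : Option Tok) =>
      ({ Reg.base N κ res with cur := x.map fun t => (t, fun _ => false) },
        stk L [] [] a [] [] nm))
    (step := fun a (t : Tok) => (t, fun _ => false) :: a) (T := 1)
    (fun _ _ _ => rfl) (fun _ _ _ => rfl) (fun _ _ _ _ => update_inp ..)
    (fun _ _ x => by cases x <;> rfl) (fun _ _ => True) (fun _ _ _ _ => trivial)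
    (fun a x L _ => ⟨some x, Run.push (update_w' ..)⟩) L [] none
    ((L.map fun t => ((t, fun _ => false) : WTok K)).reverse) trivial (by
      have : ∀ (L : List Tok) (a : List (WTok K)),
          L.foldl (fun a (t : Tok) => ((t, fun _ => false) : WTok K) :: a) a =
            (L.map fun t => ((t, fun _ => false) : WTok K)).reverse ++ a := by
        intro L
        induction L with
        | nil => simp
        | cons t L ih => intro a; simp [ih]
      exact (this L []).trans (List.append_nil _))
  refine .of (.seq h (run_restore ..)) ?_ ?_
  · simp [ann_none, setCur, Reg.base]
  · simp only [List.length_reverse, List.length_map]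
    omega

def Tok.isName : Tok → Bool
  | .bit _ => true
  | .endName => true
  | _ => false

/-- Copy the names at the beginning of the working word. -/
def copyNames (j : Fin K) : MProg K N :=
  .seq (.overWord (.ite (fun r => r.b && r.tok.1.isName) (.push .y fun r => r.tok.1)
    (.load fun r => { r with b := false }))) (.seq restore (.seq (moveNames j) .reset))

theorem run_copyNames (j : Fin K) (κ : Fin K → Option Bool) (res : Bool) (w : List (WTok K))
    {nm : Fin K → List Tok} (hnm : nm j = []) :
    Run (copyNames j) (.base N κ res, stk [] [] w [] [] [] nm)
      (.base N κ res, stk [] [] w [] [] []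
        (Function.update nm j ((w.map Prod.fst).takeWhile Tok.isName)))
      (11 * w.length + 7) := by
  let step (a : Bool × List Tok × List (WTok K)) (t : WTok K) :
      Bool × List Tok × List (WTok K) :=
    (a.1 && t.1.isName, if (a.1 && t.1.isName) = true then t.1 :: a.2.1 else a.2.1, t :: a.2.2)
  -- Once the flag is false nothing more is copied. Its final value is immaterial, as the register
  -- is reset afterwards.
  have hfold : ∀ (L : List (WTok K)) (b : Bool) (y : List Tok) (w' : List (WTok K)),
      ∃ b', L.foldl step (b, y, w') =
        (b', (if b = true then ((L.map Prod.fst).takeWhile Tok.isName).reverse else []) ++ y,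
          L.reverse ++ w') := by
    intro L
    induction L with
    | nil => intro b y w'; exact ⟨b, by cases b <;> simp⟩
    | cons t L ih =>
      intro b y w'
      rw [List.foldl_cons]
      obtain ⟨b', hb'⟩ := ih (b && t.1.isName)
        (if (b && t.1.isName) = true then t.1 :: y else y) (t :: w')
      refine ⟨b', hb'.trans ?_⟩
      cases b
      · simp
      · cases ht : t.1.isName <;> simp [ht]
  obtain ⟨b', hb'⟩ := hfold w true [] []
  have h := Run.pass (k := Stk.w) (set := setCur) (p := fun r : Reg K N => r.cur.isSome)
    (P := .seq (.ite (fun r => r.b && r.tok.1.isName) (.push .y fun r => r.tok.1)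
      (.load fun r => { r with b := false })) pushTok)
    (F := fun (a : Bool × List Tok × List (WTok K)) L x =>
      ({ Reg.base N κ res with cur := x, b := a.1 }, stk [] [] L a.2.2 a.2.1 [] nm))
    (step := step) (T := 3)
    (fun _ _ _ => rfl) (fun _ _ _ => rfl) (fun _ _ _ _ => update_w ..) (fun _ _ _ => rfl)
    (fun _ _ => True) (fun _ _ _ _ => trivial)
    (fun a x L _ => by
      refine ⟨some x, ?_⟩
      cases hp : (a.1 && x.1.isName)
      · exact .of (.seq (.ite_false hp (.load rfl)) (.push (update_w' ..)))
          (by simp [step, hp, stk, Reg.tok]) le_rfl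
      · exact .of (.seq (.ite_true hp (.push (update_y ..))) (.push (update_w' ..)))
          (by rw [Bool.and_eq_true] at hp; simp [step, hp, stk, Reg.tok]) le_rfl)
    w (true, [], []) none _ trivial hb'
  refine .of (.seq h (.seq (run_restore ..) (.seq (run_moveNames j ..) (run_reset ..)))) ?_ ?_
  · simp [hnm, setCur, setX, Reg.base]
  · have := (List.takeWhile_sublist (l := w.map Prod.fst) Tok.isName).length_le
    simp only [List.length_map] at this
    simp
    omega

/-! ### Comparing the names of a word with a given name -/

/-- Compare the current token with the next token of the list of names. -/
def compareTok (j : Fin K) : MProg K N :=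
  .ite (fun r => r.b) (.seq (.pop (.nm j) setX) (.seq (.push .y fun r => r.x.getD .sep)
    (.load fun r => { r with b := decide (r.x = some r.tok.1), x := none }))) .skip

/-- Mark the names of the working word that are equal to the first name of a list. -/
def tag (j : Fin K) : MProg K N :=
  .seq (.overWord (.ite (fun r => r.tok.1.isName)
    (.seq (compareTok j) (.ite (fun r => decide (r.tok.1 = .endName))
      (.seq (.load fun r => { r with cur := some (r.tok.1, Function.update r.tok.2 j r.b) })
        (.seq (moveNames j) (.load fun r => { r with b := true }))) .skip)) .skip)) restore

/-- The states of the comparison: whether there is agreement so far, the tokens compared, the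
remaining tokens, and the output. -/
abbrev TagState (K : ℕ) := Bool × List Tok × List Tok × List (WTok K)

def TagState.compare (a : TagState K) (t : Tok) : TagState K :=
  if a.1 = true then
    (decide (a.2.2.1.head? = some t), a.2.2.1.head?.getD .sep :: a.2.1, a.2.2.1.tail, a.2.2.2)
  else a

def TagState.step (j : Fin K) (a : TagState K) (t : WTok K) : TagState K :=
  if t.1.isName = true then
    if t.1 = .endName then
      (true, [], (a.compare t.1).2.1.reverse ++ (a.compare t.1).2.2.1,
        (t.1, Function.update t.2 j (a.compare t.1).1) :: a.2.2.2)
    else ((a.compare t.1).1, (a.compare t.1).2.1, (a.compare t.1).2.2.1, t :: a.2.2.2)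
  else (a.1, a.2.1, a.2.2.1, t :: a.2.2.2)

/-- The invariant of the comparison of `orig` with a name of which `u` has been read. -/
def TagInv (orig : List Tok) (u : List Bool) (a : TagState K) : Prop :=
  a.2.1.reverse ++ a.2.2.1 = orig ∧ (a.1 = true → a.2.1.reverse = u.map .bit) ∧
    (a.1 = false → ¬ u.map .bit <+: orig)

/-- The end marker makes the encoded names prefix-free. -/
theorem map_bit_append_inj {u x : List Bool} {L L' : List Tok}
    (h : u.map Tok.bit ++ .endName :: L = x.map Tok.bit ++ .endName :: L') : u = x := by
  induction u generalizing x with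
  | nil =>
    cases x with
    | nil => rfl
    | cons => simp at h
  | cons b u ih =>
    cases x with
    | nil => simp at h
    | cons c x =>
      simp only [List.map_cons, List.cons_append, List.cons.injEq, Tok.bit.injEq] at h
      rw [h.1, ih h.2]

/-- While the comparison succeeds, the popped tokens are the bits of `u`; after a failure `u` is not
a prefix of the list, and neither is any extension of it. The end marker is compared like a bit, so
component `j` records equality of names and not just a common prefix. -/
theorem TagInv.step {j : Fin K} {x u : List Bool} {rest : List Tok} {a : TagState K}
    {τ : Fin K → Option DVar} (h : TagInv (x.map .bit ++ .endName :: rest) u a) (t : Tok) :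
    (a.step j (annTok τ u t)).2.2.2 =
        annTok (Function.update τ j (some x)) u t :: a.2.2.2 ∧
      TagInv (x.map .bit ++ .endName :: rest) (nextName u t) (a.step j (annTok τ u t)) := by
  obtain ⟨b, y, n, w'⟩ := a
  obtain ⟨h1, h2, h3⟩ := h
  simp only at h1 h2 h3
  have hother : t.isName = false → (TagState.step j (b, y, n, w') (annTok τ u t)).2.2.2 =
        annTok (Function.update τ j (some x)) u t :: w' ∧
      TagInv (x.map .bit ++ .endName :: rest) (nextName u t)
        (TagState.step j (b, y, n, w') (annTok τ u t)) := by
    intro ht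
    have ht' : t ≠ .endName := by rintro rfl; cases ht
    have hn : nextName u t = u := by cases t <;> first | rfl | cases ht
    simp only [TagState.step, annTok, ht, if_false, ht', hn, Bool.false_eq_true, true_and]
    exact ⟨h1, h2, h3⟩
  have hpre : b = true → u.map Tok.bit ++ n = x.map Tok.bit ++ .endName :: rest := fun hb => by
    rw [← h2 hb, h1]
  cases t with
  | bit c =>
    refine ⟨by simp [TagState.step, annTok, Tok.isName], ?_⟩
    simp only [TagState.step, annTok, Tok.isName, if_true, nextName, reduceCtorEq, if_false]
    cases hb : b with
    | false =>
      refine ⟨h1, by simp [TagState.compare], fun _ hp => h3 hb ?_⟩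
      rw [List.map_append] at hp
      exact (List.prefix_append _ _).trans hp
    | true =>
      have hpre := hpre hb
      have h2 := h2 hb
      simp only [TagState.compare, if_true]
      cases n with
      | nil =>
        have : Tok.endName ∈ u.map Tok.bit ++ [] := by rw [hpre]; simp
        simp at this
      | cons t n =>
        refine ⟨by simpa using h1, fun ht => ?_, fun ht hp => ?_⟩
        · simp only [List.head?_cons, decide_eq_true_eq, Option.some.injEq] at ht
          simp [h2, ht]
        · simp only [List.head?_cons, decide_eq_false_iff_not, Option.some.injEq] at ht
          rw [← hpre, List.map_append, List.prefix_append_right_inj] at hp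
          simp at hp
          exact ht hp.symm
  | endName =>
    have hc : ((TagState.compare (b, y, n, w') .endName).2.1.reverse ++
        (TagState.compare (b, y, n, w') .endName).2.2.1) = x.map .bit ++ .endName :: rest ∧
        (TagState.compare (b, y, n, w') .endName).1 = decide (u = x) := by
      cases hb : b with
      | false =>
        refine ⟨h1, ?_⟩
        simp only [TagState.compare, Bool.false_eq_true, if_false]
        symm
        rw [decide_eq_false_iff_not]
        rintro rfl
        exact h3 hb (List.prefix_append _ _)
      | true =>
        have hpre := hpre hb
        simp only [TagState.compare, if_true]
        cases n with
        | nil =>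
          have : Tok.endName ∈ u.map Tok.bit ++ [] := by rw [hpre]; simp
          simp at this
        | cons t n =>
          refine ⟨by simpa using h1, ?_⟩
          simp only [List.head?_cons, Option.some.injEq, decide_eq_decide]
          constructor
          · rintro rfl
            exact map_bit_append_inj hpre
          · rintro rfl
            rw [List.append_right_inj, List.cons.injEq] at hpre
            exact hpre.1
    constructor
    · simp only [TagState.step, annTok, Tok.isName, if_true, hc.2, List.cons.injEq, and_true,
        Prod.mk.injEq, true_and]
      funext i
      by_cases hi : i = j
      · subst hi
        simp [flag, eq_comm]
      · simp [flag, hi]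
    · simp only [TagState.step, annTok, Tok.isName, if_true, nextName]
      exact ⟨by simpa using hc.1, by simp, by simp⟩
  | _ => exact hother rfl

theorem TagInv.foldl {j : Fin K} {x : List Bool} {rest : List Tok} {τ : Fin K → Option DVar}
    (L : List Tok) : ∀ (u : List Bool) (a : TagState K),
      TagInv (x.map .bit ++ .endName :: rest) u a →
      ((ann τ u L).foldl (TagState.step j) a).2.2.2 =
          (ann (Function.update τ j (some x)) u L).reverse ++ a.2.2.2 ∧
        TagInv (x.map .bit ++ .endName :: rest) (L.foldl nextName u)
          ((ann τ u L).foldl (TagState.step j) a) := by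
  induction L with
  | nil => exact fun u a h => ⟨rfl, h⟩
  | cons t L ih =>
    intro u a h
    obtain ⟨h1, h2⟩ := h.step (j := j) (τ := τ) t
    obtain ⟨h3, h4⟩ := ih _ _ h2
    refine ⟨?_, h4⟩
    simp only [ann, List.foldl_cons, h3, h1, List.reverse_cons, List.append_assoc,
      List.singleton_append]

/-- The empty word is a prefix of every list, so when no part of a name has been read, the
comparison is in its initial state and the list of names is intact. -/
theorem TagInv.eq_of_nil {x : List Bool} {rest : List Tok} {a : TagState K}
    (h : TagInv (x.map .bit ++ .endName :: rest) [] a) :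
    a = (true, [], x.map .bit ++ .endName :: rest, a.2.2.2) := by
  obtain ⟨b, y, n, w'⟩ := a
  obtain ⟨h1, h2, h3⟩ := h
  cases b with
  | false => exact (h3 rfl (List.nil_prefix)).elim
  | true =>
    have := h2 rfl
    simp only [List.map_nil, List.reverse_eq_nil_iff] at this
    subst this
    simpa using h1

theorem run_compareTok (j : Fin K) (r : Reg K N) (hx : r.x = none) (inp out w w' y s nm) (n) :
    Run (compareTok j) (r, stk inp out w w' y s (Function.update nm j n))
      ({ r with b := (TagState.compare (r.b, y, n, w') r.tok.1).1 },
        stk inp out w w' (TagState.compare (r.b, y, n, w') r.tok.1).2.1 s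
          (Function.update nm j (TagState.compare (r.b, y, n, w') r.tok.1).2.2.1)) 4 := by
  obtain ⟨cur, x, b, κ, res, chk⟩ := r
  obtain rfl : x = none := hx
  cases b with
  | false =>
    refine .of (.ite_false rfl (run_skip _)) ?_ (by omega)
    simp [TagState.compare]
  | true =>
    refine .of (.ite_true rfl (.seq (.pop rfl (update_nm ..)) (.seq (.push (update_y ..))
      (.load rfl)))) ?_ (by omega)
    simp [TagState.compare, stk, setX, Reg.tok]
    rfl

theorem TagState.length_compare (a : TagState K) (t : Tok) :
    (a.compare t).2.1.length ≤ a.2.1.length + 1 := by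
  unfold TagState.compare
  split <;> simp

/-- Only component `j` of the classes changes. By `hL` the word does not break off within a name, so
the list `nm j` is restored at the end. -/
theorem run_tag (j : Fin K) (κ : Fin K → Option Bool) (res : Bool) (τ : Fin K → Option DVar)
    {L : List Tok} (hL : L.foldl nextName [] = []) {nm : Fin K → List Tok} {x : List Bool}
    {rest : List Tok} (hnm : nm j = x.map .bit ++ .endName :: rest) :
    Run (tag j) (.base N κ res, stk [] [] (ann τ [] L) [] [] [] nm)
      (.base N κ res, stk [] [] (ann (Function.update τ j (some x)) [] L) [] [] [] nm)
      ((3 * (nm j).length + 20) * (L.length + 1)) := by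
  obtain ⟨h1, h2⟩ := TagInv.foldl (j := j) (x := x) (rest := rest) (τ := τ) L []
    (true, [], nm j, []) ⟨by simp [hnm], by simp, by simp⟩
  rw [hL] at h2
  have h3 := h2.eq_of_nil
  rw [h1] at h3
  have h := Run.pass (k := Stk.w) (set := setCur) (p := fun r : Reg K N => r.cur.isSome)
    (P := .seq (.ite (fun r => r.tok.1.isName)
      (.seq (compareTok j) (.ite (fun r => decide (r.tok.1 = .endName))
        (.seq (.load fun r => { r with cur := some (r.tok.1, Function.update r.tok.2 j r.b) })
          (.seq (moveNames j) (.load fun r => { r with b := true }))) .skip)) .skip) pushTok)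
    (F := fun (a : TagState K) L x =>
      ({ Reg.base N κ res with cur := x, b := a.1 },
        stk [] [] L a.2.2.2 a.2.1 [] (Function.update nm j a.2.2.1)))
    (step := TagState.step j) (T := 3 * (nm j).length + 15)
    (fun _ _ _ => rfl) (fun _ _ _ => rfl) (fun _ _ _ _ => update_w ..) (fun _ _ _ => rfl)
    (fun a L => ∃ u L₀, TagInv (x.map .bit ++ .endName :: rest) u a ∧ L = ann τ u L₀)
    (by
      rintro a t L ⟨u, L₀, ha, hL⟩
      cases L₀ with
      | nil => cases hL
      | cons t L₀ =>
        simp only [ann, List.cons.injEq] at hL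
        obtain ⟨rfl, rfl⟩ := hL
        exact ⟨_, _, (ha.step t).2, rfl⟩)
    (by
      rintro a t L ⟨u, L₀, ha, -⟩
      obtain ⟨b, y, n, w'⟩ := a
      cases ht : t.1.isName with
      | false =>
        refine ⟨some t, .of (.seq (.ite_false ht (run_skip _)) (.push (update_w' ..))) ?_
          (by omega)⟩
        simp [TagState.step, ht, stk, Reg.tok]
      | true =>
        have hc := run_compareTok j { Reg.base N κ res with cur := some t, b := b } rfl
          [] [] L w' y [] nm n
        by_cases he : t.1 = .endName
        -- The register now holds the token with its new class. The rule for a pass allows this,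
        -- since it does not fix the symbol left behind by the body.
        · refine ⟨some (t.1, Function.update t.2 j (TagState.compare (b, y, n, w') t.1).1),
            .of (.seq (.ite_true ht (.seq hc (.ite_true (decide_eq_true he)
            (.seq (.load rfl) (.seq (run_moveNames j ..) (.load rfl))))))
            (.push (update_w' ..))) ?_ ?_⟩
          · simp [TagState.step, he, Tok.isName, stk, Reg.tok, setX, Reg.base]
          · have h4 := TagState.length_compare (b, y, n, w') t.1
            have h5 := congrArg List.length ha.1
            rw [← hnm] at h5
            simp only [List.length_append, List.length_reverse] at h4 h5
            simp only [Reg.tok, Option.getD_some]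
            omega
        · refine ⟨some t, .of (.seq (.ite_true ht (.seq hc (.ite_false (decide_eq_false he)
            (run_skip _)))) (.push (update_w' ..))) ?_ (by omega)⟩
          simp [TagState.step, ht, he, stk, Reg.tok])
    (ann τ [] L) (true, [], nm j, []) none _ ⟨[], L, ⟨by simp [hnm], by simp, by simp⟩, rfl⟩ h3
  rw [Function.update_eq_self] at h
  refine .of (.seq h (run_restore ..)) ?_ ?_
  · simp [← hnm, setCur, Reg.base]
  · simp only [List.length_append, List.length_reverse, length_ann, List.length_nil]
    ring_nf
    omega

/-! ### The search -/

/-- Remove the first name of a list. -/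
def dropName (j : Fin K) : MProg K N :=
  .seq (.pop (.nm j) setX) (.seq
    (.loop (fun r => match r.x with
      | some (.bit _) => true
      | _ => false) (.pop (.nm j) setX)) .reset)

theorem run_dropName (j : Fin K) (κ : Fin K → Option Bool) (res : Bool) (w : List (WTok K))
    (x : List Bool) (rest : List Tok) : ∀ {nm : Fin K → List Tok},
    nm j = x.map .bit ++ .endName :: rest →
    Run (dropName j) (.base N κ res, stk [] [] w [] [] [] nm)
      (.base N κ res, stk [] [] w [] [] [] (Function.update nm j rest)) (2 * (nm j).length + 3) := by
  have key : ∀ (x : List Bool) (nm : Fin K → List Tok),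
      nm j = x.map .bit ++ .endName :: rest →
      Run (.loop (fun r => match r.x with
        | some (.bit _) => true
        | _ => false) (.pop (.nm j) setX))
        (setX (.base N κ res) (nm j).head?,
          stk [] [] w [] [] [] (Function.update nm j (nm j).tail))
        (setX (.base N κ res) (some .endName), stk [] [] w [] [] [] (Function.update nm j rest))
        (2 * x.length + 1) := by
    intro x
    induction x with
    | nil =>
      intro nm h
      rw [h]
      exact .of (.loop_false rfl) rfl (by simp)
    | cons b x ih =>
      intro nm h
      have ih := ih (Function.update nm j (nm j).tail) (by simp [h])
      simp only [Function.update_self, Function.update_idem] at ih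
      rw [h] at ih ⊢
      have hp : Run (.pop (.nm j) setX)
          (setX (.base N κ res) (some (.bit b)), stk [] [] w [] [] []
            (Function.update nm j (x.map .bit ++ .endName :: rest)))
          (setX (.base N κ res) (x.map Tok.bit ++ .endName :: rest).head?, stk [] [] w [] [] []
            (Function.update nm j (x.map Tok.bit ++ .endName :: rest).tail)) 1 :=
        .pop (by simp [stk, setX]) ((update_nm ..).trans (by simp [stk]))
      exact .of (.loop_true rfl hp ih) rfl (by simp; omega)
  intro nm h
  refine .of (.seq (.pop rfl (update_nm ..)) (.seq (key x nm h) (run_reset ..))) rfl ?_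
  rw [h]
  simp
  omega

/-- Try all atomic terms at the given positions. -/
def search (check : MProg K N) : List (Fin K) → MProg K N
  | [] => check
  | j :: js =>
    .seq (.load fun r => { r with κ := Function.update r.κ j (some false) }) <|
    .seq (search check js) <|
    .seq (.load fun r => { r with κ := Function.update r.κ j (some true) }) <|
    .seq (search check js) <|
    .seq (.load fun r => { r with κ := Function.update r.κ j none }) <|
    .seq (copyNames j) <|
    .seq (.peek (.nm j) setX) <|
    .loop (fun r => r.x.isSome) <|
      .seq .reset <| .seq (tag j) <| .seq (search check js) <| .seq (dropName j) <|
        .peek (.nm j) setX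

/-- Some choice of atomic terms over `l` at the given positions is good. -/
def Extends (l : List DVar) (Good : (Fin K → Atom) → Prop) (js : List (Fin K))
    (α : Fin K → Atom) : Prop :=
  ∃ α', (∀ j ∉ js, α' j = α j) ∧ (∀ j ∈ js, (α' j).Over (.vars l)) ∧ Good α'

/-- The positions in `js` are quantified away, so values left there by earlier rounds of the search
do no harm. -/
theorem extends_congr {l : List DVar} {Good : (Fin K → Atom) → Prop} {js : List (Fin K)}
    {α β : Fin K → Atom} (h : ∀ j ∉ js, α j = β j) :
    Extends l Good js α ↔ Extends l Good js β :=
  exists_congr fun _ => and_congr_left fun _ =>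
    forall_congr' fun j => forall_congr' fun hj => by rw [h j hj]

/-- The three alternatives are the three phases of `search` at position `j`; by `hj`, the later
choices do not touch this position. -/
theorem extends_cons {l : List DVar} {Good : (Fin K → Atom) → Prop} {j : Fin K}
    {js : List (Fin K)} (hj : j ∉ js) {α : Fin K → Atom} :
    Extends l Good (j :: js) α ↔ Extends l Good js (Function.update α j (.const false)) ∨
      Extends l Good js (Function.update α j (.const true)) ∨
      ∃ x ∈ l, Extends l Good js (Function.update α j (.var x)) := by
  have key : ∀ r : Atom, r.Over (.vars l) → Extends l Good js (Function.update α j r) →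
      Extends l Good (j :: js) α := by
    rintro r hr ⟨α', h1, h2, h3⟩
    refine ⟨α', fun i hi => ?_, fun i hi => ?_, h3⟩
    · rw [List.mem_cons, not_or] at hi
      rw [h1 i hi.2, Function.update_of_ne hi.1]
    · rcases List.mem_cons.1 hi with rfl | hi
      · rwa [h1 i hj, Function.update_self]
      · exact h2 i hi
  constructor
  · rintro ⟨α', h1, h2, h3⟩
    have h : Extends l Good js (Function.update α j (α' j)) := by
      refine ⟨α', fun i hi => ?_, fun i hi => h2 i (List.mem_cons_of_mem _ hi), h3⟩
      by_cases hij : i = j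
      · subst hij
        simp
      · rw [Function.update_of_ne hij]
        exact h1 i (by simp [hij, hi])
    have h4 := h2 j (by simp)
    rcases hα : α' j with x | e
    · rw [hα] at h h4
      exact Or.inr (Or.inr ⟨x, h4, h⟩)
    · rw [hα] at h
      cases e
      · exact Or.inl h
      · exact Or.inr (Or.inl h)
  · rintro (h | h | ⟨x, hx, h⟩)
    · exact key (.const false) trivial h
    · exact key (.const true) trivial h
    · exact key (.var x) hx h

/-- A bound for the time of the search. -/
def searchTime (T : ℕ) (n : ℕ) : ℕ → ℕ
  | 0 => T
  -- Two endpoints and at most `n` names are tried, which leaves one unit for overhead. The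
  -- quadratic term dominates the copying, marking and dropping of names.
  | i + 1 => (n + 3) * (searchTime T n i + 40 * (n + 1) * (n + 1))

section Search

variable {check : MProg K N} {l : List DVar} {L : List Tok} {Good : (Fin K → Atom) → Prop} {T : ℕ}

/-- The variables in use are among those of the context. -/
def ValidOff (l : List DVar) (js : List (Fin K)) (κ : Fin K → Option Bool)
    (τ : Fin K → Option DVar) : Prop :=
  ∀ j ∉ js, κ j = none → ∃ x ∈ l, τ j = some x

open Classical in
/-- The program runs as a search over the given positions. -/
def RunsSearch (P : MProg K N) (l : List DVar) (L : List Tok) (Good : (Fin K → Atom) → Prop)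
    (js : List (Fin K)) (T : ℕ) : Prop :=
  ∀ κ τ res (nm : Fin K → List Tok), ValidOff l js κ τ → (∀ j ∈ js, nm j = []) →
    ∃ κ' τ', (∀ j ∉ js, κ' j = κ j ∧ τ' j = τ j) ∧
      Run P (.base N κ res, stk [] [] (ann τ [] L) [] [] [] nm)
        (.base N κ' (res || decide (Extends l Good js (atoms κ τ))),
          stk [] [] (ann τ' [] L) [] [] [] nm) T

theorem atoms_congr {κ κ' : Fin K → Option Bool} {τ τ' : Fin K → Option DVar} {j : Fin K}
    (hκ : κ' j = κ j) (hτ : τ' j = τ j) : atoms κ' τ' j = atoms κ τ j := by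
  simp [atoms, hκ, hτ]

theorem atoms_update_const (κ : Fin K → Option Bool) (τ : Fin K → Option DVar) (j : Fin K)
    (e : Bool) : atoms (Function.update κ j (some e)) τ =
      Function.update (atoms κ τ) j (.const e) := by
  funext i
  by_cases h : i = j
  · subst h
    simp [atoms]
  · simp [atoms, h]

theorem atoms_update_var {κ : Fin K → Option Bool} (τ : Fin K → Option DVar) {j : Fin K}
    (hκ : κ j = none) (x : DVar) : atoms κ (Function.update τ j (some x)) =
      Function.update (atoms κ τ) j (.var x) := by
  funext i
  by_cases h : i = j
  · subst h
    simp [atoms, hκ]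
  · simp [atoms, h]

-- Induction on the names not yet tried, which form the content of `nm j`. A round marks the first
-- of them, so that `τ j` becomes this name, searches the remaining positions and drops it.
open Classical in
theorem run_searchLoop {P : MProg K N} (hL : L.foldl nextName [] = []) {j : Fin K}
    {js : List (Fin K)} (hj : j ∉ js) (hP : RunsSearch P l L Good js T) {n : ℕ}
    (hn : L.length ≤ n) : ∀ (l₁ : List DVar), (∀ x ∈ l₁, x ∈ l) →
    ∀ κ τ res (nm : Fin K → List Tok), κ j = none → ValidOff l (j :: js) κ τ →
    (∀ i ∈ js, nm i = []) → (l₁.flatMap encodeName).length ≤ n →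
    ∃ κ' τ', (∀ i ∉ j :: js, κ' i = κ i ∧ τ' i = τ i) ∧
      Run (.loop (fun r => r.x.isSome) <|
          .seq .reset <| .seq (tag j) <| .seq P <| .seq (dropName j) <| .peek (.nm j) setX)
        (setX (.base N κ res) (l₁.flatMap encodeName).head?,
          stk [] [] (ann τ [] L) [] [] [] (Function.update nm j (l₁.flatMap encodeName)))
        (.base N κ' (res || decide (∃ x ∈ l₁, Extends l Good js
            (Function.update (atoms κ τ) j (.var x)))),
          stk [] [] (ann τ' [] L) [] [] [] (Function.update nm j []))
        (l₁.length * (T + 30 * (n + 1) * (n + 1)) + 1) := by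
  intro l₁
  induction l₁ with
  | nil =>
    intro _ κ τ res nm _ _ _ _
    refine ⟨κ, τ, fun _ _ => ⟨rfl, rfl⟩, .of (.loop_false rfl) ?_ (by omega)⟩
    simp [setX, Reg.base]
  | cons x l₁ ih =>
    intro hl κ τ res nm hκ hv hnm hlen
    have henc : (x :: l₁).flatMap encodeName =
        x.map .bit ++ .endName :: l₁.flatMap encodeName := by simp [encodeName]
    have hlen' : (l₁.flatMap encodeName).length ≤ n := by
      rw [henc] at hlen
      simp only [List.length_append, List.length_cons, List.length_map] at hlen
      omega
    have htag := run_tag (N := N) j κ res τ hL (x := x) (rest := l₁.flatMap encodeName)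
      (nm := Function.update nm j ((x :: l₁).flatMap encodeName)) (by simp [henc])
    have hv' : ValidOff l js κ (Function.update τ j (some x)) := by
      intro i hi hκi
      by_cases h : i = j
      · subst h
        exact ⟨x, hl x (by simp), by simp⟩
      · rw [Function.update_of_ne h]
        exact hv i (by simp [h, hi]) hκi
    obtain ⟨κ₁, τ₁, h1, h2⟩ := hP κ (Function.update τ j (some x)) res
      (Function.update nm j ((x :: l₁).flatMap encodeName)) hv' (by
        intro i hi
        rw [Function.update_of_ne (by rintro rfl; exact hj hi)]
        exact hnm i hi)
    have hdrop := run_dropName (N := N) j κ₁ (res || decide (Extends l Good js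
      (atoms κ (Function.update τ j (some x))))) (ann τ₁ [] L) x (l₁.flatMap encodeName)
      (nm := Function.update nm j ((x :: l₁).flatMap encodeName)) (by simp [henc])
    have h1' : ∀ i ∉ j :: js, κ₁ i = κ i ∧ τ₁ i = τ i := by
      intro i hi
      rw [List.mem_cons, not_or] at hi
      rw [(h1 i hi.2).1, (h1 i hi.2).2, Function.update_of_ne hi.1]
      exact ⟨rfl, rfl⟩
    obtain ⟨κ', τ', h3, h4⟩ := ih (fun y hy => hl y (by simp [hy])) κ₁ τ₁ (res || decide
      (Extends l Good js (atoms κ (Function.update τ j (some x))))) nm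
      ((h1 j hj).1.trans hκ) (by
        intro i hi hκi
        rw [(h1' i hi).1] at hκi
        rw [(h1' i hi).2]
        exact hv i hi hκi) hnm hlen'
    refine ⟨κ', τ', fun i hi => ?_, ?_⟩
    · rw [(h3 i hi).1, (h3 i hi).2]
      exact h1' i hi
    · rw [Function.update_idem] at hdrop
      refine .of (.loop_true ?_ (.seq (run_reset ..) (.seq htag (.seq h2 (.seq hdrop
        (.peek (v' := setX (.base N κ₁ _) (l₁.flatMap encodeName).head?) ?_))))) h4) ?_ ?_
      · rw [henc]
        cases x <;> rfl
      · simp [stk]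
      -- The inner search may have changed `κ` and `τ` at positions in `js`, and `τ` has changed at
      -- `j`. The former are quantified away and the latter is overridden.
      · have hex : ∀ y, Extends l Good js (Function.update (atoms κ₁ τ₁) j (.var y)) ↔
            Extends l Good js (Function.update (atoms κ τ) j (.var y)) := fun y =>
          extends_congr fun i hi => by
            by_cases h : i = j
            · subst h
              simp
            · rw [Function.update_of_ne h, Function.update_of_ne h]
              have := h1' i (by simp [h, hi])
              exact atoms_congr this.1 this.2
        simp only [hex, atoms_update_var τ hκ, List.mem_cons, exists_eq_or_imp,
          Bool.decide_or, Bool.or_assoc]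
      · simp only [Function.update_self]
        have : (3 * ((x :: l₁).flatMap encodeName).length + 20) * (L.length + 1) ≤
          (3 * n + 20) * (n + 1) := Nat.mul_le_mul (by omega) (by omega)
        simp only [List.length_cons]
        nlinarith

-- Induction on the positions. By `hl`, the initial names of the word are the variables in `l`, so
-- copying them supplies precisely the variables to be tried.
open Classical in
theorem runsSearch (hL : L.foldl nextName [] = [])
    (hl : L.takeWhile Tok.isName = l.flatMap encodeName)
    (hcheck : RunsSearch check l L Good [] T) (js : List (Fin K)) (hjs : js.Nodup) :
    RunsSearch (search check js) l L Good js (searchTime T L.length js.length) := by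
  induction js with
  | nil => exact hcheck
  | cons j js ih =>
    obtain ⟨hj, hjs⟩ := List.nodup_cons.1 hjs
    have ih := ih hjs
    intro κ τ res nm hv hnm
    have hnm' : ∀ i ∈ js, nm i = [] := fun i hi => hnm i (by simp [hi])
    have hvc : ∀ κ₁ τ₁ e, (∀ i ∉ j :: js, κ₁ i = κ i ∧ τ₁ i = τ i) →
        ValidOff l js (Function.update κ₁ j (some e)) τ₁ := by
      intro κ₁ τ₁ e h i hi hκi
      by_cases hij : i = j
      · subst hij
        simp at hκi
      · have hi' : i ∉ j :: js := by simp [hij, hi]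
        rw [Function.update_of_ne hij, (h i hi').1] at hκi
        rw [(h i hi').2]
        exact hv i hi' hκi
    have hoff : ∀ {κ₁ κ₂ : Fin K → Option Bool} {τ₁ τ₂ : Fin K → Option DVar} {v : Option Bool}, (∀ i ∉ j :: js, κ₁ i = κ i ∧ τ₁ i = τ i) →
        (∀ i ∉ js, κ₂ i = Function.update κ₁ j v i ∧ τ₂ i = τ₁ i) →
        ∀ i ∉ j :: js, κ₂ i = κ i ∧ τ₂ i = τ i := by
      intro κ₁ κ₂ τ₁ τ₂ v h h' i hi
      have hi' := hi
      rw [List.mem_cons, not_or] at hi'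
      rw [(h' i hi'.2).1, (h' i hi'.2).2, Function.update_of_ne hi'.1]
      exact h i hi
    obtain ⟨κ₁, τ₁, h1, hr1⟩ := ih _ τ res nm (hvc κ τ false fun _ _ => ⟨rfl, rfl⟩) hnm'
    have h1 := hoff (fun _ _ => ⟨rfl, rfl⟩) h1
    obtain ⟨κ₂, τ₂, h2, hr2⟩ := ih _ τ₁ (res || decide (Extends l Good js
      (atoms (Function.update κ j (some false)) τ))) nm (hvc κ₁ τ₁ true h1) hnm'
    have h2 := hoff h1 h2
    have hcopy := run_copyNames (N := N) j (Function.update κ₂ j none)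
      ((res || decide (Extends l Good js (atoms (Function.update κ j (some false)) τ))) ||
        decide (Extends l Good js (atoms (Function.update κ₁ j (some true)) τ₁)))
      (ann τ₂ [] L) (hnm j (by simp))
    rw [map_fst_ann, hl] at hcopy
    have hlen : (l.flatMap encodeName).length ≤ L.length :=
      hl ▸ (List.takeWhile_sublist _).length_le
    obtain ⟨κ₃, τ₃, h3, hr3⟩ := run_searchLoop hL hj ih le_rfl l (fun _ h => h)
      (Function.update κ₂ j none) τ₂
      ((res || decide (Extends l Good js (atoms (Function.update κ j (some false)) τ))) ||
        decide (Extends l Good js (atoms (Function.update κ₁ j (some true)) τ₁))) nm (by simp) (by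
        intro i hi hκi
        have hi' := hi
        rw [List.mem_cons, not_or] at hi'
        rw [Function.update_of_ne hi'.1, (h2 i hi).1] at hκi
        rw [(h2 i hi).2]
        exact hv i hi hκi) hnm' hlen
    refine ⟨κ₃, τ₃, fun i hi => ?_, ?_⟩
    · have hi' := hi
      rw [List.mem_cons, not_or] at hi'
      rw [(h3 i hi).1, (h3 i hi).2, Function.update_of_ne hi'.1]
      exact h2 i hi
    · refine .of (.seq (.load rfl) (.seq hr1 (.seq (.load rfl) (.seq hr2 (.seq (.load rfl)
        (.seq hcopy (.seq (.peek (v' := setX (.base N _ _) (l.flatMap encodeName).head?) ?_)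
          hr3))))))) ?_ ?_
      · simp [stk]
      · have hex : ∀ {κ' : Fin K → Option Bool} {τ' : Fin K → Option DVar} (y : Atom), (∀ i ∉ j :: js, κ' i = κ i ∧ τ' i = τ i) →
            (Extends l Good js (Function.update (atoms κ' τ') j y) ↔
            Extends l Good js (Function.update (atoms κ τ) j y)) := fun y h =>
          extends_congr fun i hi => by
            by_cases hij : i = j
            · subst hij
              simp
            · rw [Function.update_of_ne hij, Function.update_of_ne hij]
              have := h i (by simp [hij, hi])
              exact atoms_congr this.1 this.2
        have h4 : ∀ i ∉ j :: js, Function.update κ₂ j none i = κ i ∧ τ₂ i = τ i :=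
          fun i hi => by
            have hi' := hi
            rw [List.mem_cons, not_or] at hi'
            rw [Function.update_of_ne hi'.1]
            exact h2 i hi
        have hnmj : Function.update nm j [] = nm := by
          rw [← hnm j (by simp), Function.update_eq_self]
        simp only [atoms_update_const, hex _ h1, hex _ h4, extends_cons hj, Bool.decide_or,
          Bool.or_assoc, hnmj]
      -- Each name is written with an end marker, so there are no more names than tokens.
      · have hll : l.length ≤ L.length := by
          refine le_trans ?_ hlen
          rw [List.length_flatMap]
          clear * -
          induction l with
          | nil => simp
          | cons x l ih =>
            simp only [List.map_cons, List.sum_cons, List.length_cons, encodeName,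
              List.length_append, List.length_map, List.length_nil] at ih ⊢
            omega
        simp only [length_ann, List.length_cons, searchTime]
        generalize searchTime T L.length js.length = t
        generalize L.length = n at *
        have hq : n + 1 ≤ (n + 1) * (n + 1) := Nat.le_mul_of_pos_left _ (by omega)
        rw [mul_assoc 30, mul_assoc 40]
        generalize (n + 1) * (n + 1) = q at *
        have := Nat.mul_le_mul_right (t + 30 * q) hll
        have h5 : (n + 3) * (t + 40 * q) = n * (t + 30 * q) + 10 * (n * q) + 3 * t + 120 * q := by
          ring
        omega

end Search

/-! ### Evaluation of boundaries -/

/-- The number of values that a token takes from the stack. -/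
def popCount (K : ℕ) : Tok → ℕ
  | .neg => 1
  | .join => 2
  | .meet => 2
  | .endEntry => K + 2
  | _ => 0

/-- The value, if any, that a token puts on the stack, given the values taken from the stack. -/
def pushVal (inCtx : Bool) (t : WTok K) (vs : List (MVal K)) : Option (MVal K) :=
  match t.1, vs with
  | .endName, _ => if inCtx = true then none else some (mvar t.2)
  | .const e, _ => some (mconst e)
  | .neg, [v] => some fun w => ((v w).2, (v w).1)
  | .join, [v, v'] => some fun w => ((v w).1 || (v' w).1, (v w).2 && (v' w).2)
  | .meet, [v, v'] => some fun w => ((v w).1 && (v' w).1, (v w).2 || (v' w).2)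
  | _, _ => none

/-- Record the class of a variable for the positions in the class. -/
def addCls (cl : Fin K → Cls K) (c : Cls K) : Fin K → Cls K := fun j => if c j = true then c else cl j

open Classical in
/-- The effect of a token on the register. -/
noncomputable def Chk.update (Γ : CellCtx) (κ : Fin K → Option Bool) (c : Chk K N) (t : WTok K) :
    Chk K N :=
  match t.1 with
  | .endName => { c with cl := if c.inCtx = true then addCls c.cl t.2 else c.cl, acc := .nil }
  | .tick => { c with ticks := ⟨min (c.ticks + 1) N, by omega⟩, acc := .nil }
  | .endEntry => { c with
      -- All cell variables are tested at once. The predicate depends on finitely many register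
      -- values, so deciding it is a matter of the transition table.
      ok := fun a => c.ok a && decide (c.isBot = true ∨ EntryOK Γ κ c.cl a c.ticks c.acc.1)
      ticks := 0
      acc := .nil }
  | .bot => { c with isBot := true, inCtx := false, acc := .nil }
  | .endCtx => { c with inCtx := false, acc := .nil }
  | _ => { c with acc := .nil }

/-- The register and the stack of values. -/
abbrev EvalState (K N : ℕ) := Chk K N × List (MVal K)

def Chk.take (c : Chk K N) (n : ℕ) (s : List (MVal K)) : Chk K N :=
  { c with acc := (s.take n).foldl BList.cons c.acc }

/-- A token takes at most `K + 2` values and puts back at most one, which is what makes its cost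
bounded. -/
noncomputable def evalTok (Γ : CellCtx) (κ : Fin K → Option Bool) (p : EvalState K N)
    (t : WTok K) : EvalState K N :=
  ((p.1.take (popCount K t.1) p.2).update Γ κ t,
    (pushVal p.1.inCtx t (p.1.take (popCount K t.1) p.2).acc.1).toList ++
      p.2.drop (popCount K t.1))

/-- Evaluation of words in which the ends of names carry classes. -/
noncomputable def evalStep (Γ : CellCtx) (κ : Fin K → Option Bool) (τ : Fin K → Option DVar)
    (p : List Bool × EvalState K N) (t : Tok) : List Bool × EvalState K N :=
  (nextName p.1 t, evalTok Γ κ p.2 (annTok τ p.1 t))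

section Eval

variable (Γ : CellCtx) (κ : Fin K → Option Bool) (τ : Fin K → Option DVar)

/-- With the name being read as part of the state, evaluation can be analysed on the plain encoding,
by induction on terms and boundaries. -/
theorem foldl_evalStep (L : List Tok) : ∀ (u : List Bool) (p : EvalState K N),
    L.foldl (evalStep Γ κ τ) (u, p) =
      (L.foldl nextName u, (ann τ u L).foldl (evalTok Γ κ) p) := by
  induction L with
  | nil => exact fun _ _ => rfl
  | cons t L ih => exact fun u p => ih _ _

/-- Collecting reverses the order of the stack, so the values appear as they were written. -/
theorem Chk.take_acc (c : Chk K N) (hc : c.acc = .nil) (n : ℕ) (s : List (MVal K))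
    (hs : (s.take n).length ≤ K + 2) : (c.take n s).acc.1 = (s.take n).reverse := by
  rw [Chk.take, hc, BList.foldl_cons_val _ _ (by simpa [BList.nil] using hs)]
  simp [BList.nil]

variable (b : Bool) (cl : Fin K → Cls K) (k : Fin (N + 1)) (ok : Fin N → Bool)
  (s : List (MVal K))

theorem eval_name_ctx (x : DVar) (u : List Bool) :
    (encodeName x).foldl (evalStep Γ κ τ) (u, ⟨true, b, cl, k, ok, .nil⟩, s) =
      ([], ⟨true, b, addCls cl (flag τ (u ++ x)), k, ok, .nil⟩, s) := by
  induction x generalizing u with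
  | nil => simp [encodeName, evalStep, evalTok, nextName, annTok, popCount, pushVal, Chk.take,
      Chk.update]
  | cons c x ih =>
    simpa [encodeName, evalStep, evalTok, nextName, annTok, popCount, pushVal, Chk.take,
      Chk.update] using ih (u ++ [c])

theorem eval_name (x : DVar) (u : List Bool) :
    (encodeName x).foldl (evalStep Γ κ τ) (u, ⟨false, b, cl, k, ok, .nil⟩, s) =
      ([], ⟨false, b, cl, k, ok, .nil⟩, mvar (flag τ (u ++ x)) :: s) := by
  induction x generalizing u with
  | nil => simp [encodeName, evalStep, evalTok, nextName, annTok, popCount, pushVal, Chk.take,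
      Chk.update]
  | cons c x ih =>
    simpa [encodeName, evalStep, evalTok, nextName, annTok, popCount, pushVal, Chk.take,
      Chk.update] using ih (u ++ [c])

theorem eval_term (r : DTerm) :
    r.encode.foldl (evalStep Γ κ τ) ([], ⟨false, b, cl, k, ok, .nil⟩, s) =
      ([], ⟨false, b, cl, k, ok, .nil⟩, mval τ r :: s) := by
  set c : Chk K N := ⟨false, b, cl, k, ok, .nil⟩
  have h1 (v : MVal K) (s) : evalStep Γ κ τ ([], c, v :: s) .neg =
      ([], c, (fun w => ((v w).2, (v w).1)) :: s) := by
    have h : (c.take 1 (v :: s)).acc.1 = [v] := Chk.take_acc c rfl 1 (v :: s) (by simp)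
    simp only [evalStep, evalTok, annTok, popCount, pushVal, h]
    rfl
  have h2 (v v' : MVal K) (s) : evalStep Γ κ τ ([], c, v' :: v :: s) .join =
      ([], c, (fun w => ((v w).1 || (v' w).1, (v w).2 && (v' w).2)) :: s) := by
    have h : (c.take 2 (v' :: v :: s)).acc.1 = [v, v'] :=
      Chk.take_acc c rfl 2 (v' :: v :: s) (by simp)
    simp only [evalStep, evalTok, annTok, popCount, pushVal, h]
    rfl
  have h3 (v v' : MVal K) (s) : evalStep Γ κ τ ([], c, v' :: v :: s) .meet =
      ([], c, (fun w => ((v w).1 && (v' w).1, (v w).2 || (v' w).2)) :: s) := by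
    have h : (c.take 2 (v' :: v :: s)).acc.1 = [v, v'] :=
      Chk.take_acc c rfl 2 (v' :: v :: s) (by simp)
    simp only [evalStep, evalTok, annTok, popCount, pushVal, h]
    rfl
  induction r generalizing s with
  | var x => exact eval_name Γ κ τ b cl k ok s x []
  | const e => rfl
  | neg r ih => rw [DTerm.encode, List.foldl_append, ih, List.foldl_cons, h1]; rfl
  | join r r' ih ih' =>
    rw [DTerm.encode, List.foldl_append, List.foldl_append, ih, ih', List.foldl_cons, h2]; rfl
  | meet r r' ih ih' =>
    rw [DTerm.encode, List.foldl_append, List.foldl_append, ih, ih', List.foldl_cons, h3]; rfl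

theorem eval_args (ψ : List DTerm) :
    (ψ.flatMap fun r => r.encode ++ [.sep]).foldl (evalStep Γ κ τ)
        ([], ⟨false, b, cl, k, ok, .nil⟩, s) =
      ([], ⟨false, b, cl, k, ok, .nil⟩, (ψ.map (mval τ)).reverse ++ s) := by
  induction ψ generalizing s with
  | nil => rfl
  | cons r ψ ih =>
    rw [List.flatMap_cons, List.foldl_append, List.foldl_append, eval_term]
    have : [Tok.sep].foldl (evalStep Γ κ τ)
        ([], (⟨false, b, cl, k, ok, .nil⟩ : Chk K N), mval τ r :: s) =
        ([], ⟨false, b, cl, k, ok, .nil⟩, mval τ r :: s) := by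
      simp [evalStep, evalTok, nextName, annTok, popCount, pushVal, Chk.take, Chk.update]
    rw [this, ih]
    simp

theorem eval_ticks (m : ℕ) (hm : k + m ≤ N) :
    (List.replicate m Tok.tick).foldl (evalStep Γ κ τ) ([], ⟨false, b, cl, k, ok, .nil⟩, s) =
      ([], ⟨false, b, cl, ⟨k + m, by omega⟩, ok, .nil⟩, s) := by
  induction m generalizing k with
  | zero => rfl
  | succ m ih =>
    have : evalStep Γ κ τ ([], (⟨false, b, cl, k, ok, .nil⟩ : Chk K N), s) .tick =
        ([], ⟨false, b, cl, ⟨k + 1, by omega⟩, ok, .nil⟩, s) := by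
      simp [evalStep, evalTok, nextName, annTok, popCount, pushVal, Chk.take, Chk.update]
      omega
    rw [List.replicate_succ, List.foldl_cons, this, ih _ (by simp only; omega)]
    simp only [Nat.add_assoc, Nat.add_comm 1 m]

-- The stack is empty before and after an entry, so taking `K + 2` values, or as many as there are,
-- yields exactly the values of this entry.
open Classical in
theorem eval_entry (n : Entry) (h1 : n.cell.head ≤ N) (h2 : n.cell.args.length ≤ K) :
    n.encode.foldl (evalStep Γ κ τ) ([], ⟨false, b, cl, 0, ok, .nil⟩, []) =
      ([], ⟨false, b, cl, 0, fun a => ok a && decide (b = true ∨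
        EntryOK Γ κ cl a n.cell.head (n.mvals τ)), .nil⟩, []) := by
  have hlen : (n.mvals τ).length ≤ K + 2 := by simpa [Entry.mvals] using h2
  have h3 : n.encode.foldl (evalStep Γ κ τ) ([], ⟨false, b, cl, 0, ok, .nil⟩, []) =
      evalStep Γ κ τ ([], ⟨false, b, cl, ⟨n.cell.head, by omega⟩, ok, .nil⟩,
        (n.mvals τ).reverse) .endEntry := by
    have he (s : List (MVal K)) : [Tok.const n.side].foldl (evalStep Γ κ τ)
        ([], (⟨false, b, cl, 0, ok, .nil⟩ : Chk K N), s) =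
        ([], ⟨false, b, cl, 0, ok, .nil⟩, mconst n.side :: s) := by
      simp [evalStep, evalTok, nextName, annTok, popCount, pushVal, Chk.take, Chk.update]
    rw [Entry.encode, List.foldl_append, List.foldl_append, List.foldl_append, eval_term, he,
      Cell.encode, List.foldl_append, eval_ticks _ _ _ _ _ _ _ _ _ (by simpa using h1), eval_args]
    simp [Entry.mvals]
  have h4 := Chk.take_acc (N := N) ⟨false, b, cl, ⟨n.cell.head, by omega⟩, ok, .nil⟩ rfl (K + 2)
    (n.mvals τ).reverse (by simp)
  rw [List.take_of_length_le (by simpa using hlen), List.reverse_reverse] at h4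
  rw [h3]
  simp only [evalStep, evalTok, annTok, popCount, pushVal, nextName, Chk.update, h4]
  rw [List.drop_of_length_le (by simpa using hlen)]
  rfl

open Classical in
theorem eval_bdy (φ : Bdy) (h : ∀ n ∈ φ, n.cell.head ≤ N ∧ n.cell.args.length ≤ K) :
    φ.encode.foldl (evalStep Γ κ τ) ([], ⟨false, b, cl, 0, ok, .nil⟩, []) =
      ([], ⟨false, b, cl, 0, fun a => ok a && decide (∀ n ∈ φ, b = true ∨
        EntryOK Γ κ cl a n.cell.head (n.mvals τ)), .nil⟩, []) := by
  induction φ generalizing ok with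
  | nil => simp [Bdy.encode]
  | cons n φ ih =>
    have hn := h n (by simp)
    have ih := fun ok => ih ok fun n hn => h n (by simp [hn])
    rw [Bdy.encode] at ih ⊢
    rw [List.flatMap_cons, List.foldl_append, eval_entry _ _ _ _ _ _ _ hn.1 hn.2, ih]
    simp only [List.mem_cons, forall_eq_or_imp, Bool.decide_and, Bool.and_assoc]

/-- The classes of the variables at all positions, given the context. -/
def ctxCls (l : List DVar) (cl : Fin K → Cls K) : Fin K → Cls K :=
  l.foldl (fun cl x => addCls cl (flag τ x)) cl

theorem eval_names (l : List DVar) :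
    (l.flatMap encodeName).foldl (evalStep Γ κ τ) ([], ⟨true, b, cl, k, ok, .nil⟩, s) =
      ([], ⟨true, b, ctxCls τ l cl, k, ok, .nil⟩, s) := by
  induction l generalizing cl with
  | nil => rfl
  | cons x l ih =>
    rw [List.flatMap_cons, List.foldl_append, eval_name_ctx, ih]
    rfl

/-- A class is recorded only at the positions it contains, so names other than `x` never overwrite
the record at `j`. The second alternative of `h` is the invariant of the induction. -/
theorem ctxCls_apply {l : List DVar} {j : Fin K} {x : DVar} (hj : τ j = some x)
    (h : x ∈ l ∨ cl j = flag τ x) : ctxCls τ l cl j = flag τ x := by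
  induction l generalizing cl with
  | nil => simpa [ctxCls] using h
  | cons y l ih =>
    refine ih (cl := addCls cl (flag τ y)) ?_
    by_cases hy : x = y
    · subst hy
      exact Or.inr (by simp [addCls, flag, hj])
    · refine h.imp (fun h => (List.mem_cons.1 h).resolve_left hy) fun h => ?_
      simp [addCls, flag, hj, hy] at h ⊢
      exact h

open Classical in
theorem eval_problem (Ψ : DCtx) (φ : Bdy)
    (h : ∀ n ∈ φ, n.cell.head ≤ N ∧ n.cell.args.length ≤ K) :
    (encodeRaw (Ψ, φ)).foldl (evalStep Γ κ τ) ([], .init K N, []) =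
      ([], ⟨false, decide (Ψ = .bot), ctxCls τ Ψ.names fun _ _ => false, 0,
        fun a => decide (∀ n ∈ φ, Ψ = .bot ∨ EntryOK Γ κ (ctxCls τ Ψ.names fun _ _ => false) a
          n.cell.head (n.mvals τ)), .nil⟩, []) := by
  cases Ψ with
  | bot =>
    rw [encodeRaw, List.foldl_append]
    have : DCtx.bot.encode.foldl (evalStep Γ κ τ) ([], Chk.init K N, []) =
        ([], ⟨false, true, fun _ _ => false, 0, fun _ => true, .nil⟩, []) := by
      simp [DCtx.encode, Chk.init, evalStep, evalTok, nextName, annTok, popCount, pushVal,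
        Chk.take, Chk.update]
    rw [this, eval_bdy _ _ _ _ _ _ _ h]
    simp [ctxCls, DCtx.names]
  | vars l =>
    rw [encodeRaw, List.foldl_append]
    have : (DCtx.vars l).encode.foldl (evalStep Γ κ τ) ([], Chk.init K N, []) =
        ([], ⟨false, false, ctxCls τ l fun _ _ => false, 0, fun _ => true, .nil⟩, []) := by
      rw [DCtx.encode, List.foldl_append, Chk.init, eval_names]
      simp [evalStep, evalTok, nextName, annTok, popCount, pushVal, Chk.take, Chk.update]
    rw [this, eval_bdy _ _ _ _ _ _ _ h]
    simp [DCtx.names]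

end Eval

/-! ### The program for the test -/

def Reg.mapChk (f : Chk K N → Chk K N) (r : Reg K N) : Reg K N := { r with chk := f r.chk }

/-- Take values from the stack. -/
def popVals : ℕ → MProg K N
  | 0 => .skip
  | n + 1 => .seq (.pop .s fun r v => r.mapChk fun c => { c with acc := v.elim c.acc c.acc.cons })
      (popVals n)

theorem run_popVals (n : ℕ) (r : Reg K N) (inp out w w' y s nm) :
    Run (popVals n) (r, stk inp out w w' y s nm)
      (r.mapChk (·.take n s), stk inp out w w' y (s.drop n) nm) (n + 1) := by
  induction n generalizing r s with
  | zero => exact run_skip _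
  | succ n ih =>
    refine .of (.seq (.pop rfl (update_s ..)) (ih _ _)) ?_ (by omega)
    cases s <;> simp [Reg.mapChk, Chk.take, stk]

/-- Take as many values from the stack as the current token requires. -/
def popArgs : MProg K N :=
  .ite (fun r => decide (popCount K r.tok.1 = 0)) (popVals 0) <|
  .ite (fun r => decide (popCount K r.tok.1 = 1)) (popVals 1) <|
  .ite (fun r => decide (popCount K r.tok.1 = 2)) (popVals 2) (popVals (K + 2))

theorem popCount_cases (K : ℕ) (t : Tok) : popCount K t = 0 ∨ popCount K t = 1 ∨
    popCount K t = 2 ∨ popCount K t = K + 2 := by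
  cases t <;> simp [popCount]

theorem run_popArgs (r : Reg K N) (inp out w w' y s nm) :
    Run popArgs (r, stk inp out w w' y s nm)
      (r.mapChk (·.take (popCount K r.tok.1) s),
        stk inp out w w' y (s.drop (popCount K r.tok.1)) nm) (K + 6) := by
  by_cases h0 : popCount K r.tok.1 = 0
  · rw [h0]
    exact .of (.ite_true (decide_eq_true h0) (run_popVals ..)) rfl (by omega)
  by_cases h1 : popCount K r.tok.1 = 1
  · rw [h1]
    exact .of (.ite_false (decide_eq_false h0) (.ite_true (decide_eq_true h1)
      (run_popVals ..))) rfl (by omega)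
  by_cases h2 : popCount K r.tok.1 = 2
  · rw [h2]
    exact .of (.ite_false (decide_eq_false h0) (.ite_false (decide_eq_false h1)
      (.ite_true (decide_eq_true h2) (run_popVals ..)))) rfl (by omega)
  have h3 : popCount K r.tok.1 = K + 2 := by
    have := popCount_cases K r.tok.1
    omega
  rw [h3]
  exact .of (.ite_false (decide_eq_false h0) (.ite_false (decide_eq_false h1)
    (.ite_false (decide_eq_false h2) (run_popVals ..)))) rfl (by omega)

/-- The value, if any, to be put on the stack. -/
def Reg.pushVal (r : Reg K N) : Option (MVal K) := Cubical.pushVal r.chk.inCtx r.tok r.chk.acc.1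

noncomputable def evalProg (Γ : CellCtx) : MProg K N :=
  .seq popArgs <| .seq
    (.ite (fun r => r.pushVal.isSome) (.push .s fun r => r.pushVal.getD (mconst false)) .skip) <|
    .load fun r => r.mapChk (·.update Γ r.κ r.tok)

theorem run_evalProg (Γ : CellCtx) (r : Reg K N) (inp out w w' y s nm) :
    Run (evalProg Γ) (r, stk inp out w w' y s nm)
      ({ r with chk := (evalTok Γ r.κ (r.chk, s) r.tok).1 },
        stk inp out w w' y (evalTok Γ r.κ (r.chk, s) r.tok).2 nm) (K + 9) := by
  set r' := r.mapChk (·.take (popCount K r.tok.1) s) with hr'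
  have hp : Run (.ite (fun r => r.pushVal.isSome)
      (.push .s fun r => r.pushVal.getD (mconst false)) .skip)
      (r', stk inp out w w' y (s.drop (popCount K r.tok.1)) nm)
      (r', stk inp out w w' y (evalTok Γ r.κ (r.chk, s) r.tok).2 nm) 2 := by
    have he : (evalTok Γ r.κ (r.chk, s) r.tok).2 =
      r'.pushVal.toList ++ s.drop (popCount K r.tok.1) := rfl
    rw [he]
    cases hv : r'.pushVal with
    | none => exact .ite_false (by simp [hv]) (run_skip _)
    | some v => exact .ite_true (by simp [hv]) (.push ((update_s ..).trans (by simp [hv, stk])))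
  exact .of (.seq (run_popArgs ..) (.seq hp (.load rfl))) rfl (by omega)

open Classical in
/-- The result of the test for a register. -/
noncomputable def Chk.good (Γ : CellCtx) (c : Chk K Γ.length) : Bool :=
  decide (∃ a d, Γ[a.1]? = some d ∧ (c.isBot = true ∨ d.ctx ≠ .bot) ∧ c.ok a = true)

/-- Test whether a cartesian cell solves the problem. -/
noncomputable def check (K : ℕ) (Γ : CellCtx) : MProg K Γ.length :=
  .seq (.overWord (evalProg Γ)) <| .seq restore <|
    .load fun r => .base _ r.κ (r.res || r.chk.good Γ)

theorem run_check (Γ : CellCtx) (κ : Fin K → Option Bool) (res : Bool) (w : List (WTok K)) (nm)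
    {c : Chk K Γ.length} (hw : w.foldl (evalTok Γ κ) (.init K _, []) = (c, [])) :
    Run (check K Γ) (.base _ κ res, stk [] [] w [] [] [] nm)
      (.base _ κ (res || c.good Γ), stk [] [] w [] [] [] nm) ((K + 15) * w.length + 5) := by
  let step (a : EvalState K Γ.length × List (WTok K)) (t : WTok K) :=
    (evalTok Γ κ a.1 t, t :: a.2)
  have hfold : ∀ (L : List (WTok K)) p w', L.foldl step (p, w') =
      (L.foldl (evalTok Γ κ) p, L.reverse ++ w') := by
    intro L
    induction L with
    | nil => simp
    | cons t L ih => intro p w'; rw [List.foldl_cons, ih]; simp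
  have h := Run.pass (k := Stk.w) (set := setCur) (p := fun r : Reg K _ => r.cur.isSome)
    (P := .seq (evalProg Γ) pushTok)
    (F := fun (a : EvalState K Γ.length × List (WTok K)) L x =>
      ({ Reg.base Γ.length κ res with cur := x, chk := a.1.1 }, stk [] [] L a.2 [] a.1.2 nm))
    (step := step) (T := K + 10)
    (fun _ _ _ => rfl) (fun _ _ _ => rfl) (fun _ _ _ _ => update_w ..) (fun _ _ _ => rfl)
    (fun _ _ => True) (fun _ _ _ _ => trivial)
    (fun a x L _ => ⟨some x, .of (.seq (run_evalProg ..) (.push (update_w' ..))) rfl le_rfl⟩)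
    w ((.init K _, []), []) none _ trivial ((hfold ..).trans (by rw [hw]))
  refine .of (.seq h (.seq (run_restore ..) (.load rfl))) ?_ ?_
  · simp [Reg.base, setCur]
  · simp only [List.length_reverse, List.length_append, List.length_nil]
    ring_nf
    omega

/-! ### Correctness of the test on encoded problems -/

variable {Γ : CellCtx}

/-- Each cell of the boundary has its head in `Γ` and as many arguments as that declaration has
names. Hence neither the counter of ticks nor the list of collected values overflows. -/
theorem BoundaryProblem.cell_bound (hK : ∀ a, (namesAt Γ a).length ≤ K) (P : BoundaryProblem Γ) :
    ∀ n ∈ P.bdy, n.cell.head ≤ Γ.length ∧ n.cell.args.length ≤ K := by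
  intro n hn
  obtain ⟨d, hd, h⟩ := (P.isBdy.isCell n hn).2
  refine ⟨((List.getElem?_eq_some_iff.1 hd).1).le, ?_⟩
  have hK := hK n.cell.head
  rw [namesAt_eq hd] at hK
  cases hc : d.ctx with
  | bot =>
    rw [hc] at h
    simp [h.2]
  | vars l =>
    rw [hc] at h hK
    exact h.1.trans_le hK

/-- The name being read is the first component of the evaluation state and is empty in the final
state; any candidate serves to see this. -/
theorem BoundaryProblem.foldl_nextName (hK : ∀ a, (namesAt Γ a).length ≤ K)
    (P : BoundaryProblem Γ) : P.encode.foldl nextName [] = [] := by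
  have h := eval_problem Γ (N := Γ.length) (fun _ => none) (fun _ : Fin K => none) P.ctx P.bdy
    (P.cell_bound hK)
  rw [foldl_evalStep] at h
  exact congrArg Prod.fst h

theorem takeWhile_names (l : List DVar) {L : List Tok} (hL : L.takeWhile Tok.isName = []) :
    (l.flatMap encodeName ++ L).takeWhile Tok.isName = l.flatMap encodeName := by
  rw [List.takeWhile_append_of_pos, hL, List.append_nil]
  intro t ht
  obtain ⟨x, -, hx⟩ := List.mem_flatMap.1 ht
  rcases List.mem_append.1 hx with hx | hx
  · obtain ⟨b, -, rfl⟩ := List.mem_map.1 hx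
    rfl
  · obtain rfl := List.mem_singleton.1 hx
    rfl

theorem BoundaryProblem.takeWhile_encode (P : BoundaryProblem Γ) :
    P.encode.takeWhile Tok.isName = P.ctx.names.flatMap encodeName := by
  cases h : P.ctx with
  | bot => simp [encode, encodeRaw, h, DCtx.encode, DCtx.names, Tok.isName]
  | vars l =>
    simp only [encode, encodeRaw, h, DCtx.encode, DCtx.names, List.append_assoc]
    exact takeWhile_names l rfl

theorem atoms_over {κ : Fin K → Option Bool} {τ : Fin K → Option DVar} {Ψ : DCtx}
    (hv : ValidOff Ψ.names [] κ τ) (j : Fin K) : (atoms κ τ j).Over Ψ := by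
  cases hκ : κ j with
  | some e => simp [atoms, hκ, Atom.Over, Atom.toTerm, DTerm.Over]
  | none =>
    obtain ⟨x, hx, hτ⟩ := hv j (by simp) hκ
    simp only [atoms, hκ, hτ, Option.getD_some]
    cases Ψ with
    | bot => simp [DCtx.names] at hx
    | vars l => exact hx

/-- A search over no positions is a single test. The pass computes one verdict per cell variable,
and `entryOK_iff` identifies it with agreement; over `⊥` every entry is satisfied. -/
theorem runsSearch_check (hΓ : IsCellCtx Γ) (hK : ∀ a, (namesAt Γ a).length ≤ K)
    (P : BoundaryProblem Γ) : RunsSearch (check K Γ) P.ctx.names P.encode (Solves P) []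
      ((K + 15) * P.encode.length + 5) := by
  classical
  intro κ τ res nm hv _
  refine ⟨κ, τ, fun _ _ => ⟨rfl, rfl⟩, ?_⟩
  have h := eval_problem Γ (N := Γ.length) κ τ P.ctx P.bdy (P.cell_bound hK)
  rw [foldl_evalStep] at h
  have h := run_check Γ κ res (ann τ [] P.encode) nm (congrArg Prod.snd h)
  rw [length_ann] at h
  refine .of h ?_ le_rfl
  congr 3
  rw [Chk.good, decide_eq_decide]
  have hE : Extends P.ctx.names (Solves P) [] (atoms κ τ) ↔ Solves P (atoms κ τ) := by
    constructor
    · rintro ⟨α, h, -, hα⟩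
      obtain rfl : α = atoms κ τ := funext fun j => h j (by simp)
      exact hα
    · exact fun h => ⟨_, fun _ _ => rfl, by simp, h⟩
  rw [hE]
  simp only [decide_eq_true_eq]
  have key : ∀ a d, Γ[a]? = some d → (P.ctx = .bot ∨ d.ctx ≠ .bot) →
      ((∀ n ∈ P.bdy, P.ctx = .bot ∨ EntryOK Γ κ (ctxCls τ P.ctx.names fun _ _ => false) a
        n.cell.head (n.mvals τ)) ↔ Agrees Γ P.ctx (cartesianCell Γ a (atoms κ τ)) P.bdy) := by
    intro a d hd hb
    have hu := isCell_cartesianCell hd (hK a) hb (atoms_over hv)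
    refine forall₂_congr fun n hn => ?_
    have hn := (P.isBdy.isCell n hn).2
    cases hΨ : P.ctx with
    | bot =>
      rw [hΨ] at hu hn
      exact iff_of_true (Or.inl rfl) (.bot rfl
        (hu.bind (fun x hx => hx.elim) fun _ => rfl) hn)
    | vars l =>
      rw [hΨ] at hu hn hv
      simp only [reduceCtorEq, false_or]
      refine entryOK_iff hΓ (fun j hj => ?_) (fun j x hj hx => ?_) hu hn
      · obtain ⟨x, -, hx⟩ := hv j (by simp) hj
        simp [hx]
      · obtain ⟨x', hx', hx''⟩ := hv j (by simp) hj
        obtain rfl : x = x' := by simpa [hx] using hx''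
        exact ctxCls_apply τ _ hx (Or.inl hx')
  constructor
  · rintro ⟨a, d, hd, hb, h⟩
    exact ⟨a, d, hd, hb, (key a d hd hb).1 h⟩
  · rintro ⟨a, d, hd, hb, h⟩
    exact ⟨⟨a, (List.getElem?_eq_some_iff.1 hd).1⟩, d, hd, hb, (key a d hd hb).2 h⟩

/-! ### The decision procedure -/

/-- The machine that runs a program and halts. -/
noncomputable def MProg.machine (P : MProg K N) (r : Reg K N) : Turing.FinTM2 where
  K := Stk K
  kFin := Fintype.ofFinite _
  k₀ := .inp
  k₁ := .out
  Γ := Alph K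
  Λ := Option P.Label
  main := some P.entry
  ΛFin := Fintype.ofFinite _
  σ := Reg K N
  initialState := r
  σFin := Fintype.ofFinite _
  Γk₀Fin := inferInstanceAs (Fintype Tok)
  m
    | some i => P.compile some none i
    | none => .halt

/-- A halting configuration must have the initial register and nothing but the output on its stacks,
so the program has to clean up. Halting itself takes the one additional step. -/
theorem MProg.nonempty_computable {P : MProg K N} {r : Reg K N} {α : Type} {enc : α → List Tok}
    {f : α → Bool} {p : Polynomial ℕ}
    (h : ∀ x, Run P (r, stk (enc x) [] [] [] [] [] fun _ => [])
      (r, stk [] [f x] [] [] [] [] fun _ => []) (p.eval (enc x).length)) :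
    Nonempty (Turing.TM2ComputableInPolyTime enc Computability.encodeBool f) := by
  choose t ht h using h
  refine ⟨⟨⟨P.machine r, Equiv.refl Tok, Equiv.refl Bool⟩, p + 1, fun x => ⟨⟨t x + 1, ?_⟩, ?_⟩⟩⟩
  · have h1 := (h x).stepsTo (m := (P.machine r).m) (emb := some) (exit := none) fun _ => rfl
    have h2 := h1.trans (StepsTo.single (m := (P.machine r).m) (l := none) rfl)
    have h3 : Turing.initList (P.machine r) ((enc x).map (Equiv.refl Tok).invFun) =
        ⟨some (some P.entry), r, stk (enc x) [] [] [] [] [] fun _ => []⟩ := by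
      refine congrArg (Turing.TM2.Cfg.mk _ _) (funext fun k => ?_)
      cases k <;> first | rfl | exact List.map_id _
    have h4 : Turing.haltList (P.machine r)
        ((Computability.encodeBool (f x)).map (Equiv.refl Bool).invFun) =
        ⟨none, r, stk [] [f x] [] [] [] [] fun _ => []⟩ := by
      refine congrArg (Turing.TM2.Cfg.mk _ _) (funext fun k => ?_)
      cases k <;> rfl
    have h5 : (flip bind (P.machine r).step)^[t x + 1] _ = _ := h2
    exact (congrArg _ (congrArg some h3)).trans (h5.trans (congrArg some h4.symm))
  · simpa using ht x

/-- Remove the working word. -/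
def clearWord : MProg K N := .pass .w setCur (fun r => r.cur.isSome) .skip

theorem run_clearWord (r : Reg K N) (inp out w w' y s nm) :
    Run clearWord (r, stk inp out w w' y s nm)
      (setCur r none, stk inp out [] w' y s nm) (3 * w.length + 2) := by
  have h := Run.pass (k := Stk.w) (set := setCur) (p := fun r : Reg K N => r.cur.isSome) (P := .skip)
    (F := fun (_ : Unit) L x => (setCur r x, stk inp out L w' y s nm)) (step := fun a _ => a)
    (T := 1) (fun _ _ _ => rfl) (fun _ _ _ => rfl) (fun _ _ _ _ => update_w ..)
    (fun _ _ _ => rfl) (fun _ _ => True) (fun _ _ _ _ => trivial)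
    (fun _ x _ _ => ⟨some x, run_skip _⟩) w () r.cur _ trivial rfl
  exact h

/-- The program that decides whether a boundary problem is solvable. -/
noncomputable def decideProg (K : ℕ) (Γ : CellCtx) : MProg K Γ.length :=
  .seq readInput <| .seq (search (check K Γ) (List.finRange K)) <|
  .seq clearWord <|
  .seq (.push .out Reg.res) <| .load fun _ => .base _ (fun _ => none) false

/-- The degree grows with the number `i` of positions, which is fixed along with `Γ`. -/
theorem exists_searchTime_eq (T : Polynomial ℕ) (i : ℕ) :
    ∃ p : Polynomial ℕ, ∀ n, p.eval n = searchTime (T.eval n) n i := by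
  induction i with
  | zero => exact ⟨T, fun _ => rfl⟩
  | succ i ih =>
    obtain ⟨p, hp⟩ := ih
    exact ⟨(.X + 3) * (p + 40 * (.X + 1) * (.X + 1)), fun n => by simp [searchTime, hp]⟩

theorem length_namesAt_le (Γ : CellCtx) (a : ℕ) :
    (namesAt Γ a).length ≤ (Γ.map fun d => d.ctx.names.length).sum := by
  cases h : Γ[a]? with
  | none => simp [namesAt, h]
  | some d =>
    rw [namesAt_eq h]
    exact List.le_sum_of_mem (List.mem_map_of_mem (List.mem_of_getElem? h))

theorem over_iff_names {Ψ : DCtx} {r : Atom} : r.Over (.vars Ψ.names) ↔ r.Over Ψ := by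
  cases Ψ with
  | vars l => rfl
  | bot => cases r <;> simp [Atom.Over, Atom.toTerm, DTerm.Over, DCtx.Mem, DCtx.names]

theorem inP_cartesianSolvable {Γ : CellCtx} (hΓ : IsCellCtx Γ) :
    InP (BoundaryProblem.encode (Γ := Γ)) CartesianSolvable := by
  classical
  obtain ⟨K, hK⟩ : ∃ K, ∀ a, (namesAt Γ a).length ≤ K := ⟨_, length_namesAt_le Γ⟩
  refine ⟨fun P => decide (CartesianSolvable P), fun _ => decide_eq_true_iff, ?_⟩
  obtain ⟨p, hp⟩ := exists_searchTime_eq ((K + 15 : ℕ) * .X + 5) K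
  -- Besides the search, reading the input takes 6n + 4 steps, clearing the word 3n + 2, and the
  -- output and the final register one each.
  refine MProg.nonempty_computable (P := decideProg K Γ) (r := .base _ (fun _ => none) false)
    (p := p + 9 * .X + 8) fun P => ?_
  obtain ⟨κ, τ, -, h⟩ := runsSearch (P.foldl_nextName hK) P.takeWhile_encode
    (runsSearch_check hΓ hK P) (List.finRange K) (List.nodup_finRange K) (fun _ => none)
    (fun _ => none) false (fun _ => []) (fun j hj => (hj (List.mem_finRange j)).elim)
    fun _ _ => rfl
  -- All positions are free, so the tuple from which the search starts does not matter.
  have hE : Extends P.ctx.names (Solves P) (List.finRange K)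
      (atoms (fun _ => none) fun _ => none) ↔ CartesianSolvable P := by
    rw [cartesianSolvable_iff P hK]
    simp [Extends, over_iff_names]
  rw [decide_eq_decide.2 hE, Bool.false_or] at h
  refine .of (.seq (run_readInput ..) (.seq h (.seq (run_clearWord ..) (.seq (.push (update_out ..))
    (.load rfl))))) rfl ?_
  simp only [length_ann, List.length_finRange, Polynomial.eval_add, Polynomial.eval_mul, hp]
  simp
  omega

end Cubical

theorem mainTheorem7 (Γ : Cubical.CellCtx) (hΓ : Cubical.IsCellCtx Γ) :
    Cubical.InP (Cubical.BoundaryProblem.encode (Γ := Γ)) Cubical.CartesianSolvable :=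
  Cubical.inP_cartesianSolvable hΓ
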